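/- Let $T>0$, $\Omega=[0,T]\times[0,T]$, $1<p<2$, $\frac1p<\alpha<1$, $0\le\beta\le1$, $p^*_\alpha=\frac{2p}{2-\alpha p}$, $p<q<r<p^*_\alpha$, $0<\gamma<1$. Let $\mu,a\in L^\infty(\Omega)$ with $\mu\ge0$ and $a>0$ a.e. in $\Omega$. Let $\psi\in C^1([0,T])$ be increasing with $\psi'\neq0$ on $[0,T]$. For $s>0$ let $$\mathbf I^{s}u(x_1,x_2)=\frac1{\Gamma(s)^2}\int_0^{x_1}\!\!\int_0^{x_2}\psi'(t_1)\psi'(t_2)(\psi(x_1)-\psi(t_1))^{s-1}(\psi(x_2)-\psi(t_2))^{s-1}u(t_1,t_2)\,dt_2\,dt_1 ,$$ let $\mathbf I^0u=u$, and for $u\in C_0^\infty(\Omega)$ (smooth, with compact support in $(0,T)^2$) let $$\mathbf Du=\mathbf I^{\beta(1-\alpha)}\Big(\frac1{\psi'(x_1)\psi'(x_2)}\frac{\partial^2}{\partial x_1\partial x_2}\Big)\mathbf I^{(1-\beta)(1-\alpha)}u .$$ Let $L^{\mathcal H}(\Omega)$ be the space of measurable $u:\Omega\to\mathbb R$ with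 $\rho(u)=\int_\Omega(|u|^p+\mu|u|^q)\,dx<\infty$, with the Luxemburg norm $\|u\|_{\mathcal H}=\inf\{\tau>0:\rho(u/\tau)\le1\}$. Let $\mathbb H$ be the completion of $C_0^\infty(\Omega)$ for the norm $\|\mathbf Du\|_{\mathcal H}+\|u\|_{\mathcal H}$, regarded as a space of functions in $L^{\mathcal H}(\Omega)$, with $\mathbf D$ extended to it by continuity. For $\lambda>0$ and $u\in\mathbb H$ put $$\mathbf E_\lambda(u)=\frac1p\int_\Omega|\mathbf Du|^p\,dx+\frac1q\int_\Omega\mu|\mathbf Du|^q\,dx-\frac1{1-\gamma}\int_\Omega a|u|^{1-\gamma}\,dx-\frac\lambda r\int_\Omega|u|^r\,dx ,$$ $$\mathbf N_\lambda=\Big\{u\in\mathbb H\setminus\{0\}:\int_\Omega|\mathbf Du|^p\,dx+\int_\Omega\mu|\mathbf Du|^q\,dx=\int_\Omega a|u|^{1-\gamma}\,dx+\lambda\int_\Omega|u|^r\,dx\Big\},$$ $$\mathbf N_\lambda^-=\Big\{u\in\mathbf N_\lambda:(p+\gamma-1)\int_\Omega|\mathbf Du|^p\,dx+(q+\gamma-1)\int_\Omega\mu|\mathbf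 Du|^q\,dx-\lambda(r+\gamma-1)\int_\Omega|u|^r\,dx<0\Big\}.$$ Then for every $\hat\lambda^*>0$ there is $\hat\lambda_0^*\in(0,\hat\lambda^*]$ such that $\mathbf E_\lambda(u)\ge0$ for all $\lambda\in(0,\hat\lambda_0^*]$ and all $u\in\mathbf N_\lambda^-$. -/

import Mathlib

open MeasureTheory Filter Topology

noncomputable section

namespace DoublePhase

/-- The square `Ω = [0,T] × [0,T]`. -/
def square (T : ℝ) : Set (ℝ × ℝ) := Set.Icc 0 T ×ˢ Set.Icc 0 T

/-- Lebesgue measure on `Ω = [0,T] × [0,T]`. -/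
def volSq (T : ℝ) : Measure (ℝ × ℝ) := (volume : Measure (ℝ × ℝ)).restrict (square T)

/-- The derivative `ψ'` of `ψ` on `[0,T]` (one-sided at the end points). -/
def dpsi (T : ℝ) (ψ : ℝ → ℝ) (s : ℝ) : ℝ := derivWithin ψ (Set.Icc 0 T) s

/-- The left-sided `ψ`-Riemann-Liouville fractional partial integral of order `s` (in each of the
two variables) based at `0`:
`(1 / Γ(s)²) ∫_0^{x₁} ∫_0^{x₂} ψ'(t₁) ψ'(t₂) (ψ(x₁)-ψ(t₁))^{s-1} (ψ(x₂)-ψ(t₂))^{s-1} u(t₁,t₂) dt₂ dt₁`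
for `s > 0`; the integral of order `0` is the identity. -/
def rlIntegral (T : ℝ) (ψ : ℝ → ℝ) (s : ℝ) (u : ℝ × ℝ → ℝ) (x : ℝ × ℝ) : ℝ :=
  if s = 0 then u x
  else
    1 / (Real.Gamma s * Real.Gamma s) *
      ∫ t₁ in (0 : ℝ)..x.1, ∫ t₂ in (0 : ℝ)..x.2,
        dpsi T ψ t₁ * dpsi T ψ t₂ * (ψ x.1 - ψ t₁) ^ (s - 1) * (ψ x.2 - ψ t₂) ^ (s - 1) * u (t₁, t₂)

/-- The operator `(1 / (ψ'(x₁) ψ'(x₂))) ∂²/∂x₁∂x₂`. -/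
def psiMixedDeriv (T : ℝ) (ψ : ℝ → ℝ) (u : ℝ × ℝ → ℝ) (x : ℝ × ℝ) : ℝ :=
  1 / (dpsi T ψ x.1 * dpsi T ψ x.2) * deriv (fun y₁ => deriv (fun y₂ => u (y₁, y₂)) x.2) x.1

/-- The left-sided `ψ`-Hilfer fractional partial derivative of order `α` and type `β`,
as a pointwise operator:
`I^{β(1-α),ψ} ( (1 / (ψ'(x₁) ψ'(x₂))) ∂²/∂x₁∂x₂ ) I^{(1-β)(1-α),ψ} u`. -/
def hilferClassical (T : ℝ) (ψ : ℝ → ℝ) (α β : ℝ) (u : ℝ × ℝ → ℝ) : ℝ × ℝ → ℝ :=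
  rlIntegral T ψ (β * (1 - α)) (psiMixedDeriv T ψ (rlIntegral T ψ ((1 - β) * (1 - α)) u))

/-- The modular `ρ(u) = ∫_Ω (|u|^p + μ(x) |u|^q) dx`, with values in `[0,∞]`. -/
def modular (T p q : ℝ) (mu : ℝ × ℝ → ℝ) (u : ℝ × ℝ → ℝ) : ENNReal :=
  ∫⁻ x, ENNReal.ofReal (|u x| ^ p + mu x * |u x| ^ q) ∂(volSq T)

/-- Membership in the Musielak-Orlicz space `L^H(Ω)`, `H(x,t) = t^p + μ(x) t^q`. -/
def MemLH (T p q : ℝ) (mu : ℝ × ℝ → ℝ) (u : ℝ × ℝ → ℝ) : Prop :=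
  AEMeasurable u (volSq T) ∧ modular T p q mu u < ⊤

/-- The Luxemburg norm `inf {τ > 0 : ρ(u/τ) ≤ 1}`, with values in `[0,∞]`
(it is `∞` if there is no such `τ`). -/
def luxNorm (T p q : ℝ) (mu : ℝ × ℝ → ℝ) (u : ℝ × ℝ → ℝ) : ENNReal :=
  ⨅ (τ : ℝ) (_ : 0 < τ) (_ : modular T p q mu (fun x => u x / τ) ≤ 1), ENNReal.ofReal τ

/-- `φ ∈ C_0^∞(Ω)`: smooth with compact support in the open square `(0,T) × (0,T)`. -/
def IsTestFun (T : ℝ) (φ : ℝ × ℝ → ℝ) : Prop :=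
  ContDiff ℝ (⊤ : ℕ∞) φ ∧ HasCompactSupport φ ∧ tsupport φ ⊆ Set.Ioo 0 T ×ˢ Set.Ioo 0 T

/-- `(u, v)` lies in the closure in `L^H(Ω) × L^H(Ω)` of the graph of the `ψ`-Hilfer derivative on
`C_0^∞(Ω)`. As this operator is closable, `v` is then determined almost everywhere by `u`. -/
def IsHilferDeriv (T : ℝ) (ψ : ℝ → ℝ) (α β p q : ℝ) (mu : ℝ × ℝ → ℝ) (u v : ℝ × ℝ → ℝ) : Prop :=
  MemLH T p q mu u ∧ MemLH T p q mu v ∧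
    ∃ φ : ℕ → ℝ × ℝ → ℝ, (∀ n, IsTestFun T (φ n)) ∧
      Tendsto (fun n => luxNorm T p q mu (fun x => φ n x - u x)) atTop (𝓝 0) ∧
      Tendsto (fun n => luxNorm T p q mu (fun x => hilferClassical T ψ α β (φ n) x - v x))
        atTop (𝓝 0)

/-- The `(ψ,H)`-fractional space with zero boundary values: the completion of `C_0^∞(Ω)` for the
norm `‖D u‖ + ‖u‖` (both Luxemburg norms), realised as a set of functions on `Ω`. -/
def fracSpace (T : ℝ) (ψ : ℝ → ℝ) (α β p q : ℝ) (mu : ℝ × ℝ → ℝ) : Set (ℝ × ℝ → ℝ) :=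
  {u | ∃ v, IsHilferDeriv T ψ α β p q mu u v}

open Classical in
/-- The `ψ`-Hilfer derivative `D u` of an element `u` of the fractional space: the extension by
closure of the operator on `C_0^∞(Ω)` (the value outside of the space is irrelevant). -/
def hilferD (T : ℝ) (ψ : ℝ → ℝ) (α β p q : ℝ) (mu : ℝ × ℝ → ℝ) (u : ℝ × ℝ → ℝ) : ℝ × ℝ → ℝ :=
  if h : ∃ v, IsHilferDeriv T ψ α β p q mu u v then h.choose else 0

/-- `‖D u‖_{L^p}^p`. -/
def gradP (T : ℝ) (ψ : ℝ → ℝ) (α β p q : ℝ) (mu : ℝ × ℝ → ℝ) (u : ℝ × ℝ → ℝ) : ℝ :=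
  ∫ x, |hilferD T ψ α β p q mu u x| ^ p ∂(volSq T)

/-- `‖D u‖_{L^q_μ}^q = ∫_Ω μ |D u|^q dx`. -/
def gradQ (T : ℝ) (ψ : ℝ → ℝ) (α β p q : ℝ) (mu : ℝ × ℝ → ℝ) (u : ℝ × ℝ → ℝ) : ℝ :=
  ∫ x, mu x * |hilferD T ψ α β p q mu u x| ^ q ∂(volSq T)

/-- The singular term `∫_Ω a |u|^{1-γ} dx`. -/
def singTerm (T γ : ℝ) (a : ℝ × ℝ → ℝ) (u : ℝ × ℝ → ℝ) : ℝ :=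
  ∫ x, a x * |u x| ^ (1 - γ) ∂(volSq T)

/-- `‖u‖_{L^r}^r`. -/
def powR (T r : ℝ) (u : ℝ × ℝ → ℝ) : ℝ :=
  ∫ x, |u x| ^ r ∂(volSq T)

/-- The energy functional `E_λ`. -/
def energy (T : ℝ) (ψ : ℝ → ℝ) (α β p q r γ : ℝ) (mu a : ℝ × ℝ → ℝ) (lam : ℝ)
    (u : ℝ × ℝ → ℝ) : ℝ :=
  1 / p * gradP T ψ α β p q mu u + 1 / q * gradQ T ψ α β p q mu u
    - 1 / (1 - γ) * singTerm T γ a u - lam / r * powR T r u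

/-- The Nehari manifold `N_λ`; `u ≠ 0` is meant in the space, so up to null sets. -/
def nehari (T : ℝ) (ψ : ℝ → ℝ) (α β p q r γ : ℝ) (mu a : ℝ × ℝ → ℝ) (lam : ℝ) :
    Set (ℝ × ℝ → ℝ) :=
  {u | u ∈ fracSpace T ψ α β p q mu ∧ ¬ u =ᵐ[volSq T] 0 ∧
    gradP T ψ α β p q mu u + gradQ T ψ α β p q mu u = singTerm T γ a u + lam * powR T r u}

/-- The part `N_λ^-` of the Nehari manifold. -/
def nehariMinus (T : ℝ) (ψ : ℝ → ℝ) (α β p q r γ : ℝ) (mu a : ℝ × ℝ → ℝ) (lam : ℝ) :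
    Set (ℝ × ℝ → ℝ) :=
  {u | u ∈ nehari T ψ α β p q r γ mu a lam ∧
    (p + γ - 1) * gradP T ψ α β p q mu u + (q + γ - 1) * gradQ T ψ α β p q mu u
      - lam * (r + γ - 1) * powR T r u < 0}

end DoublePhase

end

/-! Since `α > 1/p`, the fractional space embeds in `L^∞`. A test function is `φ = I^1 g` with `g =
∂₁∂₂φ / (ψ'(x₁) ψ'(x₂))`. The semigroup law `I^a I^b = I^(a+b)` lets `I^1` move outside
`I^((1-β)(1-α))`, where the mixed derivative cancels it. So `D φ = I^(1-α) g` and `I^α D φ = φ`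
(`exists_hilferClassical_eq`). The kernel of `I^α` is bounded in `L^p'` exactly because `α > 1/p`,
so Hölder's inequality gives `|φ| ≤ C ‖D φ‖_p` (`exists_abs_tensorOp_le`). The bound survives
closure because the Luxemburg norm dominates the `L^p` norm (`exists_ae_abs_le_of_isHilferDeriv`).

The rest is algebra (`exists_forall_energy_nonneg`). Let `A`, `B` be the two gradient terms, `S` the
singular term and `R = ∫ |u|^r`. The embedding gives `R ≤ c₁ A^(r/p)` and `S ≤ c₂ A^((1-γ)/p)`. On
`N_λ^-` one has `(p+γ-1) A < λ (r+γ-1) R`, and since `r > p` this forces `A` to be large when `λ` is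
small. Eliminating `λ R` by the Nehari identity leaves `E_λ = (1/p-1/r) A + (1/q-1/r) B -
(1/(1-γ)-1/r) S`. As `S` grows more slowly than linearly in `A`, this is nonnegative for large `A`.
-/

noncomputable section

namespace DoublePhase

/-! ### One-dimensional Riemann-Liouville kernels -/

/-- `d` is the continuous positive derivative of the function `Ψ` on the whole line. -/
structure IsIncreasingC1 (Ψ d : ℝ → ℝ) : Prop where
  cont : Continuous d
  pos : ∀ x, 0 < d x
  hasDerivAt : ∀ x, HasDerivAt Ψ (d x) x

/-- The kernel of the one-dimensional `Ψ`-Riemann-Liouville integral of order `s` based at `0`. -/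
def psiKernel (Ψ d : ℝ → ℝ) (s x t : ℝ) : ℝ :=
  if 0 < t ∧ t < x then d t * (Ψ x - Ψ t) ^ (s - 1) / Real.Gamma s else 0

/-- The integral operator in the plane whose kernel is the tensor square of `k`. -/
def tensorOp (k : ℝ → ℝ → ℝ) (g : ℝ × ℝ → ℝ) (x : ℝ × ℝ) : ℝ :=
  ∫ t : ℝ × ℝ, k x.1 t.1 * k x.2 t.2 * g t

theorem integral_Ioo_sub_rpow {A B s : ℝ} (h : A ≤ B) (hs : 0 < s) :
    ∫ w in Set.Ioo A B, (B - w) ^ (s - 1) = (B - A) ^ s / s := by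
  rw [← integral_Ioc_eq_integral_Ioo, ← intervalIntegral.integral_of_le h,
    intervalIntegral.integral_comp_sub_left (fun w => w ^ (s - 1)) B, sub_self,
    integral_rpow (Or.inl (by linarith))]
  simp [Real.zero_rpow hs.ne']

theorem integrableOn_Ioo_sub_rpow (A B : ℝ) {s : ℝ} (hs : 0 < s) :
    IntegrableOn (fun w => (B - w) ^ (s - 1)) (Set.Ioo A B) := by
  rcases le_total A B with h | h
  · have := (intervalIntegral.intervalIntegrable_rpow' (a := B - A) (b := 0)
      (r := s - 1) (by linarith)).comp_sub_left B
    simp only [sub_sub_cancel, sub_zero] at this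
    exact ((intervalIntegrable_iff_integrableOn_Ioc_of_le h).1 this).mono_set
      Set.Ioo_subset_Ioc_self
  · simp [Set.Ioo_eq_empty h.not_gt]

/-- Euler's Beta integral, rescaled and translated. All bases are nonnegative, so complex and real
powers agree. -/
theorem integral_Ioo_beta {A B a b : ℝ} (h : A < B) (ha : 0 < a) (hb : 0 < b) :
    ∫ w in Set.Ioo A B, (B - w) ^ (a - 1) * (w - A) ^ (b - 1)
      = Real.Gamma a * Real.Gamma b / Real.Gamma (a + b) * (B - A) ^ (a + b - 1) := by
  have key := Complex.betaIntegral_scaled (b : ℂ) (a : ℂ) (sub_pos.2 h)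
  have h2 : Complex.betaIntegral b a
      = ((Real.Gamma a * Real.Gamma b / Real.Gamma (a + b) : ℝ) : ℂ) := by
    rw [Complex.betaIntegral_eq_Gamma_mul_div _ _ (by simpa) (by simpa), ← Complex.ofReal_add,
      Complex.Gamma_ofReal, Complex.Gamma_ofReal, Complex.Gamma_ofReal, add_comm b a]
    push_cast
    ring
  have h3 : ∫ x in (0 : ℝ)..(B - A),
      ((x : ℂ) ^ ((b : ℂ) - 1) * (((B - A : ℝ) : ℂ) - x) ^ ((a : ℂ) - 1))
      = ((∫ x in (0 : ℝ)..(B - A), x ^ (b - 1) * (B - A - x) ^ (a - 1) : ℝ) : ℂ) := by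
    rw [← intervalIntegral.integral_ofReal]
    refine intervalIntegral.integral_congr fun x hx => ?_
    rw [Set.uIcc_of_le (sub_pos.2 h).le] at hx
    push_cast
    rw [Complex.ofReal_cpow hx.1, ← Complex.ofReal_sub, ← Complex.ofReal_sub,
      Complex.ofReal_cpow (sub_nonneg.2 hx.2)]
    push_cast
    rfl
  rw [h3, h2] at key
  have h4 : (((B - A : ℝ) : ℂ)) ^ ((b : ℂ) + a - 1) = (((B - A) ^ (a + b - 1) : ℝ) : ℂ) := by
    rw [Complex.ofReal_cpow (sub_pos.2 h).le]
    push_cast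
    ring_nf
  rw [h4, ← Complex.ofReal_mul, Complex.ofReal_inj] at key
  rw [← integral_Ioc_eq_integral_Ioo, ← intervalIntegral.integral_of_le h.le, mul_comm, ← key]
  have h5 := intervalIntegral.integral_comp_sub_right (a := A) (b := B)
    (fun x => x ^ (b - 1) * (B - A - x) ^ (a - 1)) A
  rw [sub_self] at h5
  rw [← h5]
  refine intervalIntegral.integral_congr fun x _ => ?_
  simp only [sub_sub_sub_cancel_right]
  ring

namespace IsIncreasingC1

variable {Ψ d : ℝ → ℝ}

theorem continuous (H : IsIncreasingC1 Ψ d) : Continuous Ψ :=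
  continuous_iff_continuousAt.2 fun x => (H.hasDerivAt x).continuousAt

theorem strictMono (H : IsIncreasingC1 Ψ d) : StrictMono Ψ :=
  strictMono_of_hasDerivAt_pos H.hasDerivAt H.pos

theorem image_Ioo (H : IsIncreasingC1 Ψ d) (y x : ℝ) : Ψ '' Set.Ioo y x = Set.Ioo (Ψ y) (Ψ x) := by
  refine Set.Subset.antisymm ?_ ?_
  · rintro _ ⟨t, ht, rfl⟩
    exact ⟨H.strictMono ht.1, H.strictMono ht.2⟩
  · rcases le_total y x with h | h
    · exact intermediate_value_Ioo h H.continuous.continuousOn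
    · rw [Set.Ioo_eq_empty (H.strictMono.monotone h).not_gt]
      exact Set.empty_subset _

theorem integral_Ioo_comp (H : IsIncreasingC1 Ψ d) (y x : ℝ) (F : ℝ → ℝ) :
    ∫ t in Set.Ioo y x, d t * F (Ψ t) = ∫ w in Set.Ioo (Ψ y) (Ψ x), F w := by
  rw [← H.image_Ioo, integral_image_eq_integral_abs_deriv_smul measurableSet_Ioo
    (fun t _ => (H.hasDerivAt t).hasDerivWithinAt) H.strictMono.injective.injOn]
  simp [abs_of_pos (H.pos _)]

theorem integrableOn_Ioo_comp (H : IsIncreasingC1 Ψ d) (y x : ℝ) {F : ℝ → ℝ}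
    (hF : IntegrableOn F (Set.Ioo (Ψ y) (Ψ x))) :
    IntegrableOn (fun t => d t * F (Ψ t)) (Set.Ioo y x) := by
  rw [← H.image_Ioo, integrableOn_image_iff_integrableOn_abs_deriv_smul measurableSet_Ioo
    (fun t _ => (H.hasDerivAt t).hasDerivWithinAt) H.strictMono.injective.injOn] at hF
  simpa [abs_of_pos (H.pos _)] using hF

theorem psiKernel_nonneg (H : IsIncreasingC1 Ψ d) {s : ℝ} (hs : 0 < s) (x t : ℝ) :
    0 ≤ psiKernel Ψ d s x t := by
  unfold psiKernel
  split_ifs with h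
  · exact div_nonneg (mul_nonneg (H.pos t).le
      (Real.rpow_nonneg (sub_nonneg.2 (H.strictMono h.2).le) _)) (Real.Gamma_pos_of_pos hs).le
  · exact le_rfl

theorem measurable_psiKernel (H : IsIncreasingC1 Ψ d) (s : ℝ) :
    Measurable fun z : ℝ × ℝ => psiKernel Ψ d s z.1 z.2 := by
  have h1 := H.continuous.measurable
  have h2 := H.cont.measurable
  unfold psiKernel
  refine Measurable.ite ?_ (by fun_prop) measurable_const
  exact (measurableSet_lt measurable_const measurable_snd).inter
    (measurableSet_lt measurable_snd measurable_fst)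

theorem measurable_psiKernel_right (H : IsIncreasingC1 Ψ d) (s x : ℝ) :
    Measurable (psiKernel Ψ d s x) :=
  (H.measurable_psiKernel s).comp (measurable_const.prodMk measurable_id)

theorem psiKernel_eq_indicator (s x : ℝ) : psiKernel Ψ d s x
    = (Set.Ioo 0 x).indicator fun t => d t * (Ψ x - Ψ t) ^ (s - 1) / Real.Gamma s := by
  ext t
  simp [psiKernel, Set.indicator_apply]

theorem integrable_psiKernel (H : IsIncreasingC1 Ψ d) {s : ℝ} (hs : 0 < s) (x : ℝ) :
    Integrable (psiKernel Ψ d s x) := by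
  rw [psiKernel_eq_indicator, integrable_indicator_iff measurableSet_Ioo]
  exact (H.integrableOn_Ioo_comp 0 x (integrableOn_Ioo_sub_rpow (Ψ 0) (Ψ x) hs)).div_const _

theorem integral_psiKernel (H : IsIncreasingC1 Ψ d) {s x : ℝ} (hs : 0 < s) (hx : 0 ≤ x) :
    ∫ t, psiKernel Ψ d s x t = (Ψ x - Ψ 0) ^ s / Real.Gamma (s + 1) := by
  rw [psiKernel_eq_indicator, integral_indicator measurableSet_Ioo, integral_div,
    H.integral_Ioo_comp 0 x (fun w => (Ψ x - w) ^ (s - 1)),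
    integral_Ioo_sub_rpow (H.strictMono.monotone hx) hs, Real.Gamma_add_one hs.ne', div_div]

theorem psiKernel_of_nonpos {x : ℝ} (hx : x ≤ 0) (s t : ℝ) : psiKernel Ψ d s x t = 0 := by
  rw [psiKernel, if_neg]
  rintro ⟨h1, h2⟩
  linarith

/-- The semigroup law at the level of kernels: the substitution `w = Ψ t` turns the composition into
a Beta integral. -/
theorem integral_psiKernel_mul (H : IsIncreasingC1 Ψ d) {a b : ℝ} (ha : 0 < a) (hb : 0 < b)
    (x y : ℝ) :
    ∫ t, psiKernel Ψ d a x t * psiKernel Ψ d b t y = psiKernel Ψ d (a + b) x y := by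
  by_cases hy : 0 < y ∧ y < x
  · have h1 : (fun t => psiKernel Ψ d a x t * psiKernel Ψ d b t y)
        = (Set.Ioo y x).indicator fun t => d y / (Real.Gamma a * Real.Gamma b) *
          (d t * ((Ψ x - Ψ t) ^ (a - 1) * (Ψ t - Ψ y) ^ (b - 1))) := by
      ext t
      by_cases ht : t ∈ Set.Ioo y x
      · rw [Set.indicator_of_mem ht, psiKernel, psiKernel, if_pos ⟨hy.1.trans ht.1, ht.2⟩,
          if_pos ⟨hy.1, ht.1⟩]
        ring
      · rw [Set.indicator_of_notMem ht, psiKernel, psiKernel]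
        split_ifs with h2 h3
        · exact absurd ⟨h3.2, h2.2⟩ ht
        all_goals simp
    rw [h1, integral_indicator measurableSet_Ioo, integral_const_mul,
      H.integral_Ioo_comp y x (fun w => (Ψ x - w) ^ (a - 1) * (w - Ψ y) ^ (b - 1)),
      integral_Ioo_beta (H.strictMono hy.2) ha hb, psiKernel, if_pos hy]
    have := (Real.Gamma_pos_of_pos ha).ne'
    have := (Real.Gamma_pos_of_pos hb).ne'
    field_simp
  · rw [psiKernel, if_neg hy, integral_eq_zero_of_ae]
    refine Eventually.of_forall fun t => ?_
    simp only [psiKernel, Pi.zero_apply, mul_eq_zero]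
    by_contra! h
    obtain ⟨h2, h3⟩ := h
    have h2 : 0 < t ∧ t < x := by by_contra h; simp [h] at h2
    have h3 : 0 < y ∧ y < t := by by_contra h; simp [h] at h3
    exact hy ⟨h3.1, h3.2.trans h2.2⟩

/-- The kernel is Hölder continuous in `L¹` with respect to its first variable. -/
theorem integral_abs_psiKernel_sub_le (H : IsIncreasingC1 Ψ d) {s x x' : ℝ} (hs : 0 < s) (hs1 : s ≤ 1)
    (hx : x ≤ x') :
    ∫ t, |psiKernel Ψ d s x' t - psiKernel Ψ d s x t|
      ≤ 2 * (Ψ x' - Ψ x) ^ s / Real.Gamma (s + 1) := by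
  have hG := Real.Gamma_pos_of_pos (show 0 < s + 1 by linarith)
  have hG' := Real.Gamma_pos_of_pos hs
  have hmono := H.strictMono.monotone
  rcases le_total x' 0 with h0 | h0
  · simp only [psiKernel_of_nonpos h0, psiKernel_of_nonpos (hx.trans h0), sub_self, abs_zero,
      integral_zero]
    exact div_nonneg (mul_nonneg zero_le_two (Real.rpow_nonneg (sub_nonneg.2 (hmono hx)) _)) hG.le
  rcases le_total x 0 with h1 | h1
  · simp only [psiKernel_of_nonpos h1, sub_zero, abs_of_nonneg (H.psiKernel_nonneg hs _ _),
      H.integral_psiKernel hs h0]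
    gcongr
    have h2 : (Ψ x' - Ψ 0) ^ s ≤ (Ψ x' - Ψ x) ^ s :=
      Real.rpow_le_rpow (sub_nonneg.2 (hmono h0)) (by linarith [hmono h1]) hs.le
    have := Real.rpow_nonneg (sub_nonneg.2 (hmono h0)) s
    linarith
  -- The tail of the kernel beyond `x`.
  set J : ℝ → ℝ := (Set.Ioo x x').indicator
    fun t => d t * (Ψ x' - Ψ t) ^ (s - 1) / Real.Gamma s with hJ
  have hJi : Integrable J := by
    rw [hJ, integrable_indicator_iff measurableSet_Ioo]
    exact (H.integrableOn_Ioo_comp x x' (integrableOn_Ioo_sub_rpow _ _ hs)).div_const _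
  have hJv : ∫ t, J t = (Ψ x' - Ψ x) ^ s / Real.Gamma (s + 1) := by
    rw [hJ, integral_indicator measurableSet_Ioo, integral_div,
      H.integral_Ioo_comp x x' (fun w => (Ψ x' - w) ^ (s - 1)),
      integral_Ioo_sub_rpow (hmono hx) hs, Real.Gamma_add_one hs.ne', div_div]
  -- For `s ≤ 1` the kernel decreases in its first variable once that exceeds `t`, so the difference
  -- has a fixed sign off the tail `J`. This removes the absolute value. The point `t = x` is
  -- excluded because `J` vanishes there while the kernel at `x'` need not.
  have hpt : ∀ᵐ t, |psiKernel Ψ d s x' t - psiKernel Ψ d s x t|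
      ≤ psiKernel Ψ d s x t - psiKernel Ψ d s x' t + 2 * J t := by
    filter_upwards [compl_mem_ae_iff.2 (measure_singleton x)] with t ht
    have ht : t ≠ x := ht
    by_cases h2 : t ∈ Set.Ioo x x'
    · have e1 : psiKernel Ψ d s x t = 0 := by
        rw [psiKernel, if_neg]
        exact fun h => (h.2.trans h2.1).false
      have e2 : psiKernel Ψ d s x' t = J t := by
        rw [hJ, Set.indicator_of_mem h2, psiKernel, if_pos ⟨h1.trans_lt h2.1, h2.2⟩]
      rw [e1, ← e2, sub_zero, abs_of_nonneg (H.psiKernel_nonneg hs _ _)]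
      linarith
    · have e0 : J t = 0 := Set.indicator_of_notMem h2 _
      rw [e0, abs_of_nonpos]
      · linarith
      rw [sub_nonpos]
      by_cases h3 : 0 < t ∧ t < x'
      · have h4 : t < x := lt_of_le_of_ne (not_lt.1 fun h => h2 ⟨h, h3.2⟩) ht
        rw [psiKernel, psiKernel, if_pos h3, if_pos ⟨h3.1, h4⟩]
        have h5 := H.pos t
        gcongr ?_ / _
        refine mul_le_mul_of_nonneg_left ?_ h5.le
        exact Real.rpow_le_rpow_of_nonpos (sub_pos.2 (H.strictMono h4))
          (by linarith [hmono hx]) (by linarith)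
      · rw [psiKernel, if_neg h3]
        exact H.psiKernel_nonneg hs _ _
  have i1 := H.integrable_psiKernel hs x
  have i2 := H.integrable_psiKernel hs x'
  have i3 : Integrable fun t => psiKernel Ψ d s x t - psiKernel Ψ d s x' t := i1.sub i2
  calc ∫ t, |psiKernel Ψ d s x' t - psiKernel Ψ d s x t|
      ≤ ∫ t, (psiKernel Ψ d s x t - psiKernel Ψ d s x' t + 2 * J t) :=
        integral_mono_ae (i2.sub i1).abs (i3.add (hJi.const_mul 2)) hpt
    _ = (Ψ x - Ψ 0) ^ s / Real.Gamma (s + 1) - (Ψ x' - Ψ 0) ^ s / Real.Gamma (s + 1)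
        + 2 * ((Ψ x' - Ψ x) ^ s / Real.Gamma (s + 1)) := by
        rw [integral_add i3 (hJi.const_mul 2), integral_sub i1 i2, integral_const_mul,
          hJv, H.integral_psiKernel hs h1, H.integral_psiKernel hs h0]
    _ ≤ 2 * (Ψ x' - Ψ x) ^ s / Real.Gamma (s + 1) := by
        have h6 : (Ψ x - Ψ 0) ^ s ≤ (Ψ x' - Ψ 0) ^ s :=
          Real.rpow_le_rpow (sub_nonneg.2 (hmono h1)) (by linarith [hmono hx]) hs.le
        have h7 := div_le_div_of_nonneg_right h6 hG.le
        rw [mul_div_assoc]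
        linarith

end IsIncreasingC1

/-! ### Fractional integrals in the plane: semigroup law, continuity, inversion in order one -/

namespace IsIncreasingC1

variable {Ψ d : ℝ → ℝ}

theorem measurable_psiKernel_mul (H : IsIncreasingC1 Ψ d) (s : ℝ) (x : ℝ × ℝ) :
    Measurable fun t : ℝ × ℝ => psiKernel Ψ d s x.1 t.1 * psiKernel Ψ d s x.2 t.2 :=
  ((H.measurable_psiKernel_right s x.1).comp measurable_fst).mul
    ((H.measurable_psiKernel_right s x.2).comp measurable_snd)

theorem integrable_psiKernel_mul (H : IsIncreasingC1 Ψ d) {s : ℝ} (hs : 0 < s) (x : ℝ × ℝ) :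
    Integrable fun t : ℝ × ℝ => psiKernel Ψ d s x.1 t.1 * psiKernel Ψ d s x.2 t.2 :=
  (H.integrable_psiKernel hs x.1).mul_prod (H.integrable_psiKernel hs x.2)

theorem psiKernel_mul_eq_zero {s : ℝ} {x t : ℝ × ℝ}
    (ht : t ∉ Set.Icc 0 x.1 ×ˢ Set.Icc 0 x.2) :
    psiKernel Ψ d s x.1 t.1 * psiKernel Ψ d s x.2 t.2 = 0 := by
  by_contra h
  obtain ⟨h1, h2⟩ := mul_ne_zero_iff.1 h
  have h1 : 0 < t.1 ∧ t.1 < x.1 := by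
    by_contra h; rw [psiKernel, if_neg h] at h1; exact h1 rfl
  have h2 : 0 < t.2 ∧ t.2 < x.2 := by
    by_contra h; rw [psiKernel, if_neg h] at h2; exact h2 rfl
  exact ht ⟨⟨h1.1.le, h1.2.le⟩, ⟨h2.1.le, h2.2.le⟩⟩

theorem integrable_psiKernel_mul_mul (H : IsIncreasingC1 Ψ d) {s : ℝ} (hs : 0 < s) (x : ℝ × ℝ)
    {g : ℝ × ℝ → ℝ} (hg : Continuous g) :
    Integrable fun t : ℝ × ℝ => psiKernel Ψ d s x.1 t.1 * psiKernel Ψ d s x.2 t.2 * g t := by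
  obtain ⟨M, hM⟩ := (isCompact_Icc.prod isCompact_Icc).exists_bound_of_continuousOn
    (s := Set.Icc 0 x.1 ×ˢ Set.Icc 0 x.2) hg.continuousOn
  refine ((H.integrable_psiKernel_mul hs x).mul_const M).mono'
    ((H.measurable_psiKernel_mul s x).mul hg.measurable).aestronglyMeasurable
    (Eventually.of_forall fun t => ?_)
  by_cases ht : t ∈ Set.Icc 0 x.1 ×ˢ Set.Icc 0 x.2
  · have h0 := mul_nonneg (H.psiKernel_nonneg hs x.1 t.1) (H.psiKernel_nonneg hs x.2 t.2)
    rw [norm_mul, Real.norm_of_nonneg h0]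
    exact mul_le_mul_of_nonneg_left (hM t ht) h0
  · rw [psiKernel_mul_eq_zero ht]
    simp

/-- Supplies the iterated integrability that Fubini requires in the semigroup law. -/
theorem integrable_psiKernel_mul_primitive (H : IsIncreasingC1 Ψ d) {a b : ℝ} (ha : 0 < a)
    (hb : 0 < b) (x : ℝ) :
    Integrable fun t => psiKernel Ψ d a x t * ∫ y, psiKernel Ψ d b t y := by
  have hmeas : AEStronglyMeasurable (fun t => ∫ y, psiKernel Ψ d b t y) volume :=
    (H.measurable_psiKernel b).stronglyMeasurable.integral_prod_right.aestronglyMeasurable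
  refine ((H.integrable_psiKernel ha x).mul_const ((Ψ x - Ψ 0) ^ b / Real.Gamma (b + 1))).mono'
    ((H.measurable_psiKernel_right a x).aestronglyMeasurable.mul hmeas)
    (Eventually.of_forall fun t => ?_)
  rw [norm_mul, Real.norm_of_nonneg (H.psiKernel_nonneg ha x t)]
  by_cases ht : 0 < t ∧ t < x
  · refine mul_le_mul_of_nonneg_left ?_ (H.psiKernel_nonneg ha x t)
    have h0 : 0 ≤ Ψ t - Ψ 0 := sub_nonneg.2 (H.strictMono.monotone ht.1.le)
    have hG := Real.Gamma_pos_of_pos (show 0 < b + 1 by linarith)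
    rw [H.integral_psiKernel hb ht.1.le,
      Real.norm_of_nonneg (div_nonneg (Real.rpow_nonneg h0 _) hG.le)]
    gcongr
    exact (H.strictMono ht.2).le
  · rw [psiKernel, if_neg ht]
    simp

/-- The semigroup property of the Riemann-Liouville integrals. -/
theorem tensorOp_tensorOp (H : IsIncreasingC1 Ψ d) {a b : ℝ} (ha : 0 < a) (hb : 0 < b)
    {g : ℝ × ℝ → ℝ} (hg : Measurable g) {M : ℝ} (hM : ∀ y, |g y| ≤ M) (x : ℝ × ℝ) :
    tensorOp (psiKernel Ψ d a) (tensorOp (psiKernel Ψ d b) g) x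
      = tensorOp (psiKernel Ψ d (a + b)) g x := by
  set k : ℝ × ℝ → ℝ := fun t => psiKernel Ψ d a x.1 t.1 * psiKernel Ψ d a x.2 t.2 with hk
  set l : ℝ × ℝ → ℝ × ℝ → ℝ :=
    fun t y => psiKernel Ψ d b t.1 y.1 * psiKernel Ψ d b t.2 y.2 with hl
  have hk0 : ∀ t, 0 ≤ k t := fun t =>
    mul_nonneg (H.psiKernel_nonneg ha _ _) (H.psiKernel_nonneg ha _ _)
  have hl0 : ∀ t y, 0 ≤ l t y := fun t y =>
    mul_nonneg (H.psiKernel_nonneg hb _ _) (H.psiKernel_nonneg hb _ _)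
  have hkm : Measurable k := H.measurable_psiKernel_mul a x
  have hlm : Measurable fun z : (ℝ × ℝ) × (ℝ × ℝ) => l z.1 z.2 :=
    ((H.measurable_psiKernel b).comp
      ((measurable_fst.comp measurable_fst).prodMk (measurable_fst.comp measurable_snd))).mul
    ((H.measurable_psiKernel b).comp
      ((measurable_snd.comp measurable_fst).prodMk (measurable_snd.comp measurable_snd)))
  have hli : ∀ t, ∫ y, l t y
      = (∫ y, psiKernel Ψ d b t.1 y) * ∫ y, psiKernel Ψ d b t.2 y := fun t =>
    integral_prod_mul (psiKernel Ψ d b t.1) (psiKernel Ψ d b t.2)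
  -- The kernels are nonnegative, so their product is integrable by Tonelli; the bounded factor `g`
  -- is then dominated.
  have hkl : Integrable (fun z : (ℝ × ℝ) × (ℝ × ℝ) => k z.1 * l z.1 z.2)
      (volume.prod volume) := by
    have hm : AEStronglyMeasurable (fun z : (ℝ × ℝ) × (ℝ × ℝ) => k z.1 * l z.1 z.2)
        (volume.prod volume) := ((hkm.comp measurable_fst).mul hlm).aestronglyMeasurable
    rw [integrable_prod_iff hm]
    refine ⟨Eventually.of_forall fun t => (H.integrable_psiKernel_mul hb t).const_mul (k t), ?_⟩
    have h1 := (H.integrable_psiKernel_mul_primitive ha hb x.1).mul_prod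
      (H.integrable_psiKernel_mul_primitive ha hb x.2)
    refine h1.congr (Eventually.of_forall fun t => ?_)
    simp only [norm_mul, Real.norm_of_nonneg (hk0 _), Real.norm_of_nonneg (hl0 _ _),
      integral_const_mul, hli]
    simp only [hk]
    ring
  have hint : Integrable (Function.uncurry fun (t y : ℝ × ℝ) => k t * l t y * g y)
      (volume.prod volume) := by
    refine (hkl.mul_const M).mono'
      (((hkm.comp measurable_fst).mul hlm).mul (hg.comp measurable_snd)).aestronglyMeasurable
      (Eventually.of_forall fun z => ?_)
    have h0 := mul_nonneg (hk0 z.1) (hl0 z.1 z.2)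
    simp only [Function.uncurry]
    rw [norm_mul, Real.norm_of_nonneg h0]
    exact mul_le_mul_of_nonneg_left (hM _) h0
  calc tensorOp (psiKernel Ψ d a) (tensorOp (psiKernel Ψ d b) g) x
      = ∫ t, ∫ y, k t * l t y * g y := by
        refine integral_congr_ae (Eventually.of_forall fun t => ?_)
        simp only [tensorOp, mul_assoc (k t), integral_const_mul]
        rfl
    _ = ∫ y, ∫ t, k t * l t y * g y := integral_integral_swap hint
    _ = tensorOp (psiKernel Ψ d (a + b)) g x := by
        refine integral_congr_ae (Eventually.of_forall fun y => ?_)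
        simp only
        rw [integral_mul_const, ← H.integral_psiKernel_mul ha hb x.1 y.1,
          ← H.integral_psiKernel_mul ha hb x.2 y.2, ← integral_prod_mul]
        congr 1
        refine integral_congr_ae (Eventually.of_forall fun t => ?_)
        simp only [hk, hl]
        ring

theorem integral_abs_psiKernel_sub_le_abs (H : IsIncreasingC1 Ψ d) {s : ℝ} (hs : 0 < s)
    (hs1 : s ≤ 1) (x x' : ℝ) :
    ∫ t, |psiKernel Ψ d s x' t - psiKernel Ψ d s x t|
      ≤ 2 * |Ψ x' - Ψ x| ^ s / Real.Gamma (s + 1) := by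
  rcases le_total x x' with h | h
  · rw [abs_of_nonneg (sub_nonneg.2 (H.strictMono.monotone h))]
    exact H.integral_abs_psiKernel_sub_le hs hs1 h
  · rw [abs_sub_comm (Ψ x'), abs_of_nonneg (sub_nonneg.2 (H.strictMono.monotone h))]
    simp only [abs_sub_comm (psiKernel Ψ d s x' _)]
    exact H.integral_abs_psiKernel_sub_le hs hs1 h

/-- A difference of tensor squares telescopes into two products, each with one factor that is small
in `L¹` by the Hölder estimate for the kernel. -/
theorem continuous_tensorOp (H : IsIncreasingC1 Ψ d) {s : ℝ} (hs : 0 < s) (hs1 : s ≤ 1)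
    {g : ℝ × ℝ → ℝ} (hg : Continuous g) {M : ℝ} (hM : ∀ y, |g y| ≤ M) :
    Continuous (tensorOp (psiKernel Ψ d s) g) := by
  have hM0 : 0 ≤ M := (abs_nonneg _).trans (hM 0)
  set ω : ℝ → ℝ → ℝ := fun y y' => 2 * |Ψ y' - Ψ y| ^ s / Real.Gamma (s + 1) with hω
  -- The kernel based at `0` vanishes, so the modulus taken from `0` also bounds the `L¹` norm.
  set N : ℝ → ℝ := fun y => ω 0 y with hN
  have hcω : ∀ y, Continuous (ω y) := fun y => by
    have := H.continuous
    exact (continuous_const.mul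
      (Continuous.rpow_const (by fun_prop) fun _ => Or.inr hs.le)).div_const _
  have hNle : ∀ y, ∫ t, |psiKernel Ψ d s y t| ≤ N y := fun y => by
    have := H.integral_abs_psiKernel_sub_le_abs hs hs1 0 y
    simpa only [psiKernel_of_nonpos le_rfl, sub_zero] using this
  have key : ∀ x x' : ℝ × ℝ,
      |tensorOp (psiKernel Ψ d s) g x' - tensorOp (psiKernel Ψ d s) g x|
        ≤ (ω x.1 x'.1 * N x'.2 + N x.1 * ω x.2 x'.2) * M := by
    intro x x'
    have i1 : ∀ y y', Integrable fun t => |psiKernel Ψ d s y' t - psiKernel Ψ d s y t| :=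
      fun y y' => ((H.integrable_psiKernel hs y').sub (H.integrable_psiKernel hs y)).abs
    have i2 : ∀ y, Integrable fun t => |psiKernel Ψ d s y t| :=
      fun y => (H.integrable_psiKernel hs y).abs
    have j1 := (i1 x.1 x'.1).mul_prod (i2 x'.2)
    have j2 := (i2 x.1).mul_prod (i1 x.2 x'.2)
    rw [tensorOp, tensorOp, ← integral_sub (H.integrable_psiKernel_mul_mul hs x' hg)
      (H.integrable_psiKernel_mul_mul hs x hg), ← Real.norm_eq_abs]
    refine (norm_integral_le_integral_norm _).trans ?_
    refine (integral_mono_of_nonneg (μ := volume) (Eventually.of_forall fun t => norm_nonneg _)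
      ((j1.add j2).mul_const M) (Eventually.of_forall fun t => ?_)).trans ?_
    · simp only [Pi.add_apply]
      rw [← sub_mul, norm_mul]
      refine mul_le_mul ?_ (hM t) (norm_nonneg _) (by positivity)
      rw [Real.norm_eq_abs, ← abs_mul, ← abs_mul]
      refine le_trans (le_of_eq ?_) (abs_add_le _ _)
      congr 1
      ring
    · rw [integral_mul_const]
      refine mul_le_mul_of_nonneg_right ?_ hM0
      have e1 := integral_prod_mul (μ := volume) (ν := volume)
        (fun t => |psiKernel Ψ d s x'.1 t - psiKernel Ψ d s x.1 t|)
        (fun t => |psiKernel Ψ d s x'.2 t|)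
      have e2 := integral_prod_mul (μ := volume) (ν := volume)
        (fun t => |psiKernel Ψ d s x.1 t|)
        (fun t => |psiKernel Ψ d s x'.2 t - psiKernel Ψ d s x.2 t|)
      refine (integral_add j1 j2).trans_le ?_
      refine (congrArg₂ (· + ·) e1 e2).trans_le ?_
      have n : ∀ f : ℝ → ℝ, 0 ≤ ∫ t, |f t| := fun f => integral_nonneg fun t => abs_nonneg _
      have p1 := H.integral_abs_psiKernel_sub_le_abs hs hs1 x.1 x'.1
      have p2 := H.integral_abs_psiKernel_sub_le_abs hs hs1 x.2 x'.2
      exact add_le_add (mul_le_mul p1 (hNle _) (n _) ((n _).trans p1))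
        (mul_le_mul (hNle _) p2 (n _) ((n _).trans (hNle _)))
  refine continuous_iff_continuousAt.2 fun x => tendsto_iff_dist_tendsto_zero.2 ?_
  have hc : Continuous fun x' : ℝ × ℝ => (ω x.1 x'.1 * N x'.2 + N x.1 * ω x.2 x'.2) * M := by
    have h1 := hcω x.1
    have h2 := hcω x.2
    have h3 := hcω 0
    simp only [hN]
    fun_prop
  have h0 : (ω x.1 x.1 * N x.2 + N x.1 * ω x.2 x.2) * M = 0 := by
    simp [hω, Real.zero_rpow hs.ne']
  have := hc.tendsto x
  rw [h0] at this
  exact squeeze_zero (fun _ => dist_nonneg) (fun x' => key x x') this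

theorem tensorOp_eq_intervalIntegral (H : IsIncreasingC1 Ψ d) {s : ℝ} (hs : 0 < s)
    {g : ℝ × ℝ → ℝ} (hg : Continuous g) {x : ℝ × ℝ} (h1 : 0 ≤ x.1) (h2 : 0 ≤ x.2) :
    tensorOp (psiKernel Ψ d s) g x = ∫ t₁ in (0 : ℝ)..x.1, ∫ t₂ in (0 : ℝ)..x.2,
      d t₁ * (Ψ x.1 - Ψ t₁) ^ (s - 1) / Real.Gamma s *
        (d t₂ * (Ψ x.2 - Ψ t₂) ^ (s - 1) / Real.Gamma s) * g (t₁, t₂) := by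
  rw [tensorOp, Measure.volume_eq_prod, integral_prod _ (H.integrable_psiKernel_mul_mul hs x hg),
    intervalIntegral.integral_of_le h1, integral_Ioc_eq_integral_Ioo,
    ← integral_indicator measurableSet_Ioo]
  refine integral_congr_ae (Eventually.of_forall fun t₁ => ?_)
  simp only [psiKernel_eq_indicator]
  by_cases ht1 : t₁ ∈ Set.Ioo 0 x.1
  · rw [Set.indicator_of_mem ht1, Set.indicator_of_mem ht1, intervalIntegral.integral_of_le h2,
      integral_Ioc_eq_integral_Ioo, ← integral_indicator measurableSet_Ioo]
    refine integral_congr_ae (Eventually.of_forall fun t₂ => ?_)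
    by_cases ht2 : t₂ ∈ Set.Ioo 0 x.2
    · simp only [Set.indicator_of_mem ht2]
    · simp only [Set.indicator_of_notMem ht2, mul_zero, zero_mul]
  · simp [Set.indicator_of_notMem ht1]

/-- The second factor of the Hilfer derivative inverts the integral of order one. -/
theorem deriv_deriv_tensorOp_one (H : IsIncreasingC1 Ψ d) {g : ℝ × ℝ → ℝ} (hg : Continuous g)
    {x : ℝ × ℝ} (h1 : 0 < x.1) (h2 : 0 < x.2) :
    deriv (fun y₁ => deriv (fun y₂ => tensorOp (psiKernel Ψ d 1) g (y₁, y₂)) x.2) x.1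
      = d x.1 * d x.2 * g x := by
  have hd := H.cont
  -- The integrals are swapped so that `y₂`, the variable differentiated first, is the outer upper
  -- limit; the fundamental theorem of calculus then applies twice.
  have hfor : ∀ y₁ > 0, ∀ y₂ > 0, tensorOp (psiKernel Ψ d 1) g (y₁, y₂)
      = ∫ t₂ in (0 : ℝ)..y₂, ∫ t₁ in (0 : ℝ)..y₁, d t₁ * d t₂ * g (t₁, t₂) := by
    intro y₁ hy₁ y₂ hy₂
    rw [H.tensorOp_eq_intervalIntegral one_pos hg hy₁.le hy₂.le]
    simp only [sub_self, Real.rpow_zero, Real.Gamma_one, mul_one, div_one]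
    refine intervalIntegral_intervalIntegral_swap ?_
    have hc : Continuous (Function.uncurry fun t₁ t₂ => d t₁ * d t₂ * g (t₁, t₂)) := by
      simp only [Function.uncurry_def]
      fun_prop
    exact (hc.continuousOn.integrableOn_compact
      (isCompact_uIcc.prod isCompact_uIcc)).mono_set
      (Set.prod_mono Set.uIoc_subset_uIcc Set.uIoc_subset_uIcc)
  have hin : ∀ y₁ > 0, deriv (fun y₂ => tensorOp (psiKernel Ψ d 1) g (y₁, y₂)) x.2
      = ∫ t₁ in (0 : ℝ)..y₁, d t₁ * d x.2 * g (t₁, x.2) := by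
    intro y₁ hy₁
    have hc : Continuous fun t₂ => ∫ t₁ in (0 : ℝ)..y₁, d t₁ * d t₂ * g (t₁, t₂) :=
      intervalIntegral.continuous_parametric_intervalIntegral_of_continuous' (by fun_prop) _ _
    rw [← (hc.integral_hasStrictDerivAt 0 x.2).hasDerivAt.deriv]
    refine EventuallyEq.deriv_eq ?_
    filter_upwards [lt_mem_nhds h2] with y₂ hy₂ using hfor y₁ hy₁ y₂ hy₂
  have hc : Continuous fun t₁ => d t₁ * d x.2 * g (t₁, x.2) := by fun_prop
  have := (hc.integral_hasStrictDerivAt 0 x.1).hasDerivAt.deriv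
  rw [Prod.mk.eta] at this
  rw [← this]
  refine EventuallyEq.deriv_eq ?_
  filter_upwards [lt_mem_nhds h1] with y₁ hy₁ using hin y₁ hy₁

end IsIncreasingC1

/-! ### Inverting the Hilfer derivative on test functions -/

/-- The derivative is nonnegative by monotonicity and nonzero, hence positive. Extending it by its
end values and integrating gives a function on the whole line, which frees the kernel calculus from
end-point conditions. -/
theorem exists_isIncreasingC1_extension {T : ℝ} (hT : 0 < T) {ψ : ℝ → ℝ}
    (hψ : ContDiffOn ℝ 1 ψ (Set.Icc 0 T)) (hψ_mono : StrictMonoOn ψ (Set.Icc 0 T))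
    (hψ_deriv : ∀ x ∈ Set.Icc 0 T, derivWithin ψ (Set.Icc 0 T) x ≠ 0) :
    ∃ Ψ d : ℝ → ℝ, IsIncreasingC1 Ψ d ∧ Set.EqOn Ψ ψ (Set.Icc 0 T) ∧
      Set.EqOn d (dpsi T ψ) (Set.Icc 0 T) := by
  have hc : ContinuousOn (dpsi T ψ) (Set.Icc 0 T) :=
    hψ.continuousOn_derivWithin (uniqueDiffOn_Icc hT) le_rfl
  set d : ℝ → ℝ := Set.IccExtend hT.le ((Set.Icc 0 T).domRestrict (dpsi T ψ)) with hd
  have hdc : Continuous d := hc.domRestrict.Icc_extend'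
  have hdeq : Set.EqOn d (dpsi T ψ) (Set.Icc 0 T) := fun x hx => by
    rw [hd, Set.IccExtend_of_mem hT.le _ hx]
    rfl
  refine ⟨fun x => ψ 0 + ∫ t in (0 : ℝ)..x, d t, d, ⟨hdc, fun x => ?_, fun x => ?_⟩,
    fun x hx => ?_, hdeq⟩
  · have hm := (Set.projIcc 0 T hT.le x).2
    exact lt_of_le_of_ne (hψ_mono.monotoneOn.derivWithin_nonneg) (hψ_deriv _ hm).symm
  · exact (hdc.integral_hasStrictDerivAt 0 x).hasDerivAt.const_add _
  · have h1 : Set.Icc 0 x ⊆ Set.Icc 0 T := Set.Icc_subset_Icc_right hx.2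
    have := intervalIntegral.integral_eq_sub_of_hasDerivAt_of_le (f := ψ) (f' := d) hx.1
      (hψ.continuousOn.mono h1) (fun y hy => ?_) (hdc.intervalIntegrable _ _)
    · simp only [this]
      ring
    · have hy' : y ∈ Set.Ioo 0 T := ⟨hy.1, hy.2.trans_le hx.2⟩
      rw [hdeq (Set.Ioo_subset_Icc_self hy')]
      exact ((hψ.differentiableOn one_ne_zero y
        (Set.Ioo_subset_Icc_self hy')).hasDerivWithinAt).hasDerivAt (Icc_mem_nhds hy'.1 hy'.2)

/-- The Riemann-Liouville integral of order `s ≥ 0` in both variables. -/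
def rlOp (Ψ d : ℝ → ℝ) (s : ℝ) (g : ℝ × ℝ → ℝ) : ℝ × ℝ → ℝ :=
  if s = 0 then g else tensorOp (psiKernel Ψ d s) g

/-- The open square `(0,T) × (0,T)`. -/
def openSquare (T : ℝ) : Set (ℝ × ℝ) := Set.Ioo 0 T ×ˢ Set.Ioo 0 T

theorem isOpen_openSquare (T : ℝ) : IsOpen (openSquare T) := isOpen_Ioo.prod isOpen_Ioo

namespace IsIncreasingC1

variable {Ψ d : ℝ → ℝ}

theorem continuous_rlOp (H : IsIncreasingC1 Ψ d) {s : ℝ} (hs : 0 ≤ s) (hs1 : s ≤ 1)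
    {g : ℝ × ℝ → ℝ} (hg : Continuous g) {M : ℝ} (hM : ∀ y, |g y| ≤ M) :
    Continuous (rlOp Ψ d s g) := by
  unfold rlOp
  split_ifs with h
  · exact hg
  · exact H.continuous_tensorOp (lt_of_le_of_ne hs (Ne.symm h)) hs1 hg hM

theorem rlOp_rlOp (H : IsIncreasingC1 Ψ d) {a b : ℝ} (ha : 0 ≤ a) (hb : 0 ≤ b)
    {g : ℝ × ℝ → ℝ} (hg : Continuous g) {M : ℝ} (hM : ∀ y, |g y| ≤ M) :
    rlOp Ψ d a (rlOp Ψ d b g) = rlOp Ψ d (a + b) g := by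
  rcases ha.eq_or_lt with rfl | ha
  · simp [rlOp]
  rcases hb.eq_or_lt with rfl | hb
  · simp [rlOp]
  simp only [rlOp, ha.ne', hb.ne', (add_pos ha hb).ne', if_false]
  exact funext fun x => H.tensorOp_tensorOp ha hb hg.measurable hM x

/-- For `x` in the open square the integration region stays in that square up to a null set. The
pointwise operators can therefore be composed knowing their arguments only there. -/
theorem rlIntegral_eq_rlOp (H : IsIncreasingC1 Ψ d) {T : ℝ} {ψ : ℝ → ℝ}
    (hΨ : Set.EqOn Ψ ψ (Set.Icc 0 T)) (hd : Set.EqOn d (dpsi T ψ) (Set.Icc 0 T))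
    {s : ℝ} (hs : 0 ≤ s) {u h : ℝ × ℝ → ℝ} (hh : Continuous h)
    (hu : Set.EqOn u h (openSquare T)) :
    Set.EqOn (rlIntegral T ψ s u) (rlOp Ψ d s h) (openSquare T) := by
  intro x hx
  unfold rlIntegral rlOp
  split_ifs with hs0
  · exact hu hx
  have h1 := hx.1
  have h2 := hx.2
  rw [H.tensorOp_eq_intervalIntegral (lt_of_le_of_ne hs (Ne.symm hs0)) hh h1.1.le h2.1.le,
    ← intervalIntegral.integral_const_mul]
  refine intervalIntegral.integral_congr_ae_restrict ?_
  rw [Set.uIoc_of_le h1.1.le, ← restrict_Ioo_eq_restrict_Ioc]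
  filter_upwards [ae_restrict_mem measurableSet_Ioo] with t₁ ht1
  rw [← intervalIntegral.integral_const_mul]
  refine intervalIntegral.integral_congr_ae_restrict ?_
  rw [Set.uIoc_of_le h2.1.le, ← restrict_Ioo_eq_restrict_Ioc]
  filter_upwards [ae_restrict_mem measurableSet_Ioo] with t₂ ht2
  have m1 : t₁ ∈ Set.Ioo 0 T := ⟨ht1.1, ht1.2.trans h1.2⟩
  have m2 : t₂ ∈ Set.Ioo 0 T := ⟨ht2.1, ht2.2.trans h2.2⟩
  have i : Set.Ioo 0 T ⊆ Set.Icc 0 T := Set.Ioo_subset_Icc_self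
  rw [hu (show (t₁, t₂) ∈ openSquare T from ⟨m1, m2⟩), hΨ (i m1), hΨ (i m2), hd (i m1),
    hd (i m2), hΨ (i h1), hΨ (i h2)]
  ring

theorem psiMixedDeriv_eq (H : IsIncreasingC1 Ψ d) {T : ℝ} {ψ : ℝ → ℝ}
    (hd : Set.EqOn d (dpsi T ψ) (Set.Icc 0 T)) {w h : ℝ × ℝ → ℝ} (hh : Continuous h)
    (hw : Set.EqOn w (rlOp Ψ d 1 h) (openSquare T)) :
    Set.EqOn (psiMixedDeriv T ψ w) h (openSquare T) := by
  intro x hx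
  have h1 := hx.1
  have h2 := hx.2
  have i : Set.Ioo 0 T ⊆ Set.Icc 0 T := Set.Ioo_subset_Icc_self
  have e : deriv (fun y₁ => deriv (fun y₂ => w (y₁, y₂)) x.2) x.1 = d x.1 * d x.2 * h x := by
    rw [← H.deriv_deriv_tensorOp_one hh h1.1 h2.1]
    refine EventuallyEq.deriv_eq ?_
    filter_upwards [Ioo_mem_nhds h1.1 h1.2] with y₁ hy₁
    refine EventuallyEq.deriv_eq ?_
    filter_upwards [Ioo_mem_nhds h2.1 h2.2] with y₂ hy₂
    rw [hw (show (y₁, y₂) ∈ openSquare T from ⟨hy₁, hy₂⟩), rlOp, if_neg one_ne_zero]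
  rw [psiMixedDeriv, e, ← hd (i h1), ← hd (i h2)]
  have := (H.pos x.1).ne'
  have := (H.pos x.2).ne'
  field_simp

/-- A test function is the integral of order one of a bounded continuous function. -/
theorem exists_eq_rlOp_one (H : IsIncreasingC1 Ψ d) {T : ℝ} {φ : ℝ × ℝ → ℝ}
    (hφ : IsTestFun T φ) :
    ∃ g : ℝ × ℝ → ℝ, Continuous g ∧ (∃ M, ∀ y, |g y| ≤ M) ∧
      Set.EqOn φ (rlOp Ψ d 1 g) (openSquare T) := by
  obtain ⟨hsm, hcs, hsupp⟩ := hφ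
  set φ₁ : ℝ × ℝ → ℝ := fun x => fderiv ℝ φ x (1, 0) with hφ₁
  have hsm₁ : ContDiff ℝ (⊤ : ℕ∞) φ₁ :=
    (hsm.fderiv_right (m := (⊤ : ℕ∞)) (by simp)).clm_apply contDiff_const
  have hcs₁ : HasCompactSupport φ₁ := hcs.fderiv_apply (𝕜 := ℝ) _
  set φ₂ : ℝ × ℝ → ℝ := fun x => fderiv ℝ φ₁ x (0, 1) with hφ₂
  have hsm₂ : Continuous φ₂ :=
    (hsm₁.continuous_fderiv (by simp)).clm_apply continuous_const
  have hcs₂ : HasCompactSupport φ₂ := hcs₁.fderiv_apply (𝕜 := ℝ) _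
  -- The support avoids the axes, so no boundary terms arise when integrating back from `0`.
  have hz : ∀ x : ℝ × ℝ, (x.1 = 0 ∨ x.2 = 0) → φ x = 0 ∧ φ₁ x = 0 := by
    intro x hx
    have hx' : x ∉ tsupport φ := fun h => by
      have := hsupp h
      rcases hx with hx | hx
      · exact this.1.1.ne' hx
      · exact this.2.1.ne' hx
    refine ⟨image_eq_zero_of_notMem_tsupport hx', ?_⟩
    have : fderiv ℝ φ x = 0 :=
      image_eq_zero_of_notMem_tsupport fun h => hx' (tsupport_fderiv_subset ℝ h)
    simp [hφ₁, this]
  have hdc := H.cont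
  have hd0 := fun x => (H.pos x).ne'
  -- The division cancels the weight `d x.1 * d x.2` carried by the kernel of order one.
  set g : ℝ × ℝ → ℝ := fun x => φ₂ x * (d x.1 * d x.2)⁻¹ with hg
  have hgc : Continuous g := hsm₂.mul
    (Continuous.inv₀ (by fun_prop) fun x => mul_ne_zero (hd0 _) (hd0 _))
  have hgs : HasCompactSupport g := hcs₂.mul_right
  refine ⟨g, hgc, ?_, fun x hx => ?_⟩
  · obtain ⟨M, hM⟩ := hgs.exists_bound_of_continuous hgc
    exact ⟨M, hM⟩
  rw [rlOp, if_neg one_ne_zero, H.tensorOp_eq_intervalIntegral one_pos hgc hx.1.1.le hx.2.1.le]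
  have hinner : ∀ t₁, ∫ t₂ in (0 : ℝ)..x.2, d t₁ * (Ψ x.1 - Ψ t₁) ^ ((1 : ℝ) - 1) / Real.Gamma 1 *
        (d t₂ * (Ψ x.2 - Ψ t₂) ^ ((1 : ℝ) - 1) / Real.Gamma 1) * g (t₁, t₂) = φ₁ (t₁, x.2) := by
    intro t₁
    have h1 : ∀ t₂ : ℝ, HasDerivAt (fun t => φ₁ (t₁, t)) (φ₂ (t₁, t₂)) t₂ := fun t₂ => by
      have e1 := (hsm₁.differentiable (by simp) (t₁, t₂)).hasFDerivAt
      exact e1.comp_hasDerivAt t₂ ((hasDerivAt_const t₂ t₁).prodMk (hasDerivAt_id t₂))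
    have h2 := intervalIntegral.integral_eq_sub_of_hasDerivAt (a := 0) (b := x.2)
      (fun t _ => h1 t) ((hsm₂.comp (by fun_prop)).intervalIntegrable _ _)
    rw [(hz (t₁, 0) (Or.inr rfl)).2, sub_zero] at h2
    rw [← h2]
    refine intervalIntegral.integral_congr fun t₂ _ => ?_
    have := hd0 t₁
    have := hd0 t₂
    simp only [hg, sub_self, Real.rpow_zero, Real.Gamma_one]
    field_simp
  simp only [hinner]
  have h1 : ∀ t₁ : ℝ, HasDerivAt (fun t => φ (t, x.2)) (φ₁ (t₁, x.2)) t₁ := fun t₁ => by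
    have e1 := (hsm.differentiable (by simp) (t₁, x.2)).hasFDerivAt
    exact e1.comp_hasDerivAt t₁ ((hasDerivAt_id t₁).prodMk (hasDerivAt_const t₁ x.2))
  rw [intervalIntegral.integral_eq_sub_of_hasDerivAt (fun t _ => h1 t)
    ((hsm₁.continuous.comp (by fun_prop)).intervalIntegrable _ _), (hz (0, x.2) (Or.inl rfl)).1,
    sub_zero]

/-- The fractional integral of order `α` inverts the Hilfer derivative on test functions. -/
theorem exists_hilferClassical_eq (H : IsIncreasingC1 Ψ d) {T : ℝ} {ψ : ℝ → ℝ}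
    (hΨ : Set.EqOn Ψ ψ (Set.Icc 0 T)) (hd : Set.EqOn d (dpsi T ψ) (Set.Icc 0 T))
    {α β : ℝ} (hα0 : 0 < α) (hα1 : α ≤ 1) (hβ0 : 0 ≤ β) (hβ1 : β ≤ 1) {φ : ℝ × ℝ → ℝ}
    (hφ : IsTestFun T φ) :
    ∃ v : ℝ × ℝ → ℝ, Continuous v ∧ Set.EqOn (hilferClassical T ψ α β φ) v (openSquare T) ∧
      Set.EqOn φ (tensorOp (psiKernel Ψ d α) v) (openSquare T) := by
  obtain ⟨g, hg, ⟨M, hM⟩, hφg⟩ := H.exists_eq_rlOp_one hφ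
  have hα1' : 0 ≤ 1 - α := sub_nonneg.2 hα1
  have hβ1' : 0 ≤ 1 - β := sub_nonneg.2 hβ1
  have hb : 0 ≤ (1 - β) * (1 - α) := mul_nonneg hβ1' hα1'
  have hc : 0 ≤ β * (1 - α) := mul_nonneg hβ0 hα1'
  have hb1 : (1 - β) * (1 - α) ≤ 1 := mul_le_one₀ (by linarith) hα1' (by linarith)
  have h1 := H.rlIntegral_eq_rlOp hΨ hd hb
    (H.continuous_rlOp zero_le_one le_rfl hg hM) hφg
  -- Commuting the two orders places `I^1` outermost, where the mixed derivative undoes it.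
  rw [H.rlOp_rlOp hb zero_le_one hg hM, add_comm, ← H.rlOp_rlOp zero_le_one hb hg hM] at h1
  have hbc := H.continuous_rlOp hb hb1 hg hM
  have h2 := H.rlIntegral_eq_rlOp hΨ hd hc hbc (H.psiMixedDeriv_eq hd hbc h1)
  have e : β * (1 - α) + (1 - β) * (1 - α) = 1 - α := by ring
  rw [H.rlOp_rlOp hc hb hg hM, e] at h2
  refine ⟨rlOp Ψ d (1 - α) g, H.continuous_rlOp hα1' (by linarith) hg hM, h2, ?_⟩
  have h3 := H.rlOp_rlOp hα0.le hα1' hg hM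
  rw [add_sub_cancel, rlOp, if_neg hα0.ne'] at h3
  rwa [h3]

/-! ### Boundedness of the fractional integral from `L^p` to `L^∞` -/

/-- The power `(α-1) p'` of `Ψ x - Ψ t` is that of a kernel of order `(α-1) p' + 1`; the surplus
power of `d` is absorbed by its bound `D`. -/
theorem psiKernel_rpow_le (H : IsIncreasingC1 Ψ d) {T D α p' : ℝ}
    (hD : ∀ t ∈ Set.Icc 0 T, d t ≤ D) (hα : 0 < α) (hp' : 1 ≤ p') (hκ : 0 < (α - 1) * p' + 1)
    {x : ℝ} (hx : x ≤ T) (t : ℝ) :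
    psiKernel Ψ d α x t ^ p' ≤ D ^ (p' - 1) * Real.Gamma ((α - 1) * p' + 1) / Real.Gamma α ^ p' *
      psiKernel Ψ d ((α - 1) * p' + 1) x t := by
  have hp0 : 0 < p' := by linarith
  by_cases ht : 0 < t ∧ t < x
  · have hd0 := H.pos t
    have hdD := hD t ⟨ht.1.le, (ht.2.trans_le hx).le⟩
    have hG := Real.Gamma_pos_of_pos hα
    have hG2 := Real.Gamma_pos_of_pos hκ
    have hw : 0 < Ψ x - Ψ t := sub_pos.2 (H.strictMono ht.2)
    rw [psiKernel, psiKernel, if_pos ht, if_pos ht,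
      Real.div_rpow (mul_nonneg hd0.le (Real.rpow_nonneg hw.le _)) hG.le,
      Real.mul_rpow hd0.le (Real.rpow_nonneg hw.le _), ← Real.rpow_mul hw.le, add_sub_cancel_right]
    have h1 : d t ^ p' ≤ D ^ (p' - 1) * d t := by
      have : d t ^ p' = d t ^ (p' - 1) * d t := by
        rw [Real.rpow_sub_one hd0.ne']
        field_simp
      rw [this]
      exact mul_le_mul_of_nonneg_right (Real.rpow_le_rpow hd0.le hdD (by linarith)) hd0.le
    have h2 := mul_le_mul_of_nonneg_right h1 (Real.rpow_nonneg hw.le ((α - 1) * p'))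
    have h3 := div_le_div_of_nonneg_right h2 (Real.rpow_nonneg hG.le p')
    refine h3.trans (le_of_eq ?_)
    generalize Real.Gamma ((α - 1) * p' + 1) = G at hG2
    field_simp
  · rw [psiKernel, psiKernel, if_neg ht, if_neg ht, Real.zero_rpow hp0.ne', mul_zero]

/-- For `α > 1 / p` the fractional integral of order `α` is bounded from `L^p` to `L^∞`. -/
theorem exists_abs_tensorOp_le (H : IsIncreasingC1 Ψ d) {T α p : ℝ} (hT : 0 < T)
    (hp : 1 < p) (hα : 1 / p < α) :
    ∃ C : ℝ, 0 ≤ C ∧ ∀ v : ℝ × ℝ → ℝ, Continuous v → ∀ x ∈ openSquare T,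
      |tensorOp (psiKernel Ψ d α) v x| ≤ C * (∫ t, |v t| ^ p ∂(volSq T)) ^ (1 / p) := by
  have hα0 : 0 < α := lt_trans (by positivity) hα
  have hconj := (Real.HolderConjugate.conjExponent hp).symm
  set p' := p.conjExponent with hp'
  have hp'1 : 1 < p' := hconj.lt
  -- By conjugacy this number is `p' (α - 1/p)`: here `α > 1/p` enters.
  have hκ : 0 < (α - 1) * p' + 1 := by
    have h1 := hconj.inv_add_inv_eq_one
    have h2 : 0 < p' := by linarith
    have h3 : (α - 1) * p' + 1 = p' * (α - 1 / p) := by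
      have : p' * (p'⁻¹ + p⁻¹) = p' * 1 := by rw [h1]
      rw [mul_add, mul_inv_cancel₀ h2.ne'] at this
      rw [one_div]
      linarith
    rw [h3]
    exact mul_pos h2 (sub_pos.2 hα)
  set κ := (α - 1) * p' + 1
  obtain ⟨D, hD⟩ := isCompact_Icc.exists_bound_of_continuousOn (s := Set.Icc 0 T)
    H.cont.continuousOn
  have hD' : ∀ t ∈ Set.Icc 0 T, d t ≤ D := fun t ht => (le_abs_self _).trans (hD t ht)
  have hD0 : 0 ≤ D := (norm_nonneg _).trans (hD 0 ⟨le_rfl, hT.le⟩)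
  set c := D ^ (p' - 1) * Real.Gamma κ / Real.Gamma α ^ p' with hc
  have hGα := Real.Gamma_pos_of_pos hα0
  have hGκ := Real.Gamma_pos_of_pos hκ
  have hGκ1 := Real.Gamma_pos_of_pos (show 0 < κ + 1 by linarith)
  have hc0 : 0 ≤ c := by positivity
  set K := c * ((Ψ T - Ψ 0) ^ κ / Real.Gamma (κ + 1)) with hK
  have hΨT : 0 ≤ Ψ T - Ψ 0 := sub_nonneg.2 (H.strictMono.monotone hT.le)
  have hK0 : 0 ≤ K := by positivity
  have hone : ∀ x ∈ Set.Ioo 0 T, Integrable (fun t => psiKernel Ψ d α x t ^ p') ∧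
      ∫ t, psiKernel Ψ d α x t ^ p' ≤ K := by
    intro x hx
    have hle := H.psiKernel_rpow_le hD' hα0 hp'1.le hκ hx.2.le
    have hint : Integrable (fun t => psiKernel Ψ d α x t ^ p') := by
      refine ((H.integrable_psiKernel hκ x).const_mul c).mono'
        ((H.measurable_psiKernel_right α x).pow_const p').aestronglyMeasurable
        (Eventually.of_forall fun t => ?_)
      rw [Real.norm_of_nonneg (Real.rpow_nonneg (H.psiKernel_nonneg hα0 _ _) _)]
      exact hle t
    refine ⟨hint, (integral_mono hint ((H.integrable_psiKernel hκ x).const_mul c) hle).trans ?_⟩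
    rw [integral_const_mul, H.integral_psiKernel hκ hx.1.le]
    refine mul_le_mul_of_nonneg_left ?_ hc0
    gcongr
    · exact sub_nonneg.2 (H.strictMono.monotone hx.1.le)
    · exact H.strictMono.monotone hx.2.le
  refine ⟨(K * K) ^ (1 / p'), by positivity, fun v hv x hx => ?_⟩
  set k : ℝ × ℝ → ℝ := fun t => psiKernel Ψ d α x.1 t.1 * psiKernel Ψ d α x.2 t.2 with hk
  have hk0 : ∀ t, 0 ≤ k t := fun t =>
    mul_nonneg (H.psiKernel_nonneg hα0 _ _) (H.psiKernel_nonneg hα0 _ _)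
  have hkp : (fun t => k t ^ p')
      = fun t => psiKernel Ψ d α x.1 t.1 ^ p' * psiKernel Ψ d α x.2 t.2 ^ p' := funext fun t =>
    Real.mul_rpow (H.psiKernel_nonneg hα0 _ _) (H.psiKernel_nonneg hα0 _ _)
  have hkpi : Integrable fun t => k t ^ p' := by
    rw [hkp]
    exact (hone x.1 hx.1).1.mul_prod (hone x.2 hx.2).1
  have hkpv : ∫ t, k t ^ p' ≤ K * K := by
    rw [hkp]
    refine (integral_prod_mul (μ := volume) (ν := volume) (fun t => psiKernel Ψ d α x.1 t ^ p')
      (fun t => psiKernel Ψ d α x.2 t ^ p')).trans_le ?_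
    exact mul_le_mul (hone x.1 hx.1).2 (hone x.2 hx.2).2
      (integral_nonneg fun t => Real.rpow_nonneg (H.psiKernel_nonneg hα0 _ _) _) hK0
  have hkm : AEStronglyMeasurable k (volSq T) :=
    (H.measurable_psiKernel_mul α x).aestronglyMeasurable
  have hsq : IsCompact (square T) := isCompact_Icc.prod isCompact_Icc
  have hkL : MemLp k (ENNReal.ofReal p') (volSq T) := by
    have hp0 : 0 < p' := by linarith
    rw [← integrable_norm_rpow_iff hkm (by simpa) ENNReal.ofReal_ne_top,
      ENNReal.toReal_ofReal hp0.le]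
    simp only [Real.norm_of_nonneg (hk0 _)]
    exact hkpi.restrict
  have hvL : MemLp (fun t => |v t|) (ENNReal.ofReal p) (volSq T) := by
    have hp0 : 0 < p := by linarith
    rw [← integrable_norm_rpow_iff (hv.abs.aestronglyMeasurable) (by simpa) ENNReal.ofReal_ne_top,
      ENNReal.toReal_ofReal hp0.le]
    have : Continuous fun t => ‖|v t|‖ ^ p :=
      Continuous.rpow_const (by fun_prop) fun _ => Or.inr hp0.le
    exact this.continuousOn.integrableOn_compact hsq
  have hres : ∫ t, k t * |v t| = ∫ t, k t * |v t| ∂(volSq T) := by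
    refine (setIntegral_eq_integral_of_forall_compl_eq_zero fun t ht => ?_).symm
    have : k t = 0 := psiKernel_mul_eq_zero fun h => ht
      ⟨⟨h.1.1, h.1.2.trans hx.1.2.le⟩, ⟨h.2.1, h.2.2.trans hx.2.2.le⟩⟩
    rw [this, zero_mul]
  calc |tensorOp (psiKernel Ψ d α) v x| ≤ ∫ t, k t * |v t| := by
        rw [← Real.norm_eq_abs]
        refine (norm_integral_le_integral_norm _).trans (le_of_eq ?_)
        refine integral_congr_ae (Eventually.of_forall fun t => ?_)
        simp only
        rw [norm_mul, Real.norm_eq_abs (v t), Real.norm_of_nonneg (hk0 t)]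
    _ = ∫ t, k t * |v t| ∂(volSq T) := hres
    _ ≤ (∫ t, k t ^ p' ∂(volSq T)) ^ (1 / p') * (∫ t, |v t| ^ p ∂(volSq T)) ^ (1 / p) :=
        integral_mul_le_Lp_mul_Lq_of_nonneg hconj (Eventually.of_forall hk0)
          (Eventually.of_forall fun t => abs_nonneg _) hkL hvL
    _ ≤ (K * K) ^ (1 / p') * (∫ t, |v t| ^ p ∂(volSq T)) ^ (1 / p) := by
        refine mul_le_mul_of_nonneg_right ?_
          (Real.rpow_nonneg (integral_nonneg fun t => Real.rpow_nonneg (abs_nonneg _) _) _)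
        refine Real.rpow_le_rpow (integral_nonneg fun t => Real.rpow_nonneg (hk0 t) _) ?_
          (by have : 0 < p' := by linarith
              positivity)
        exact (setIntegral_le_integral hkpi
          (Eventually.of_forall fun t => Real.rpow_nonneg (hk0 t) _)).trans hkpv

end IsIncreasingC1

/-! ### Comparison of the Luxemburg norm with the `L^p` norm -/

theorem volSq_eq_restrict_openSquare (T : ℝ) :
    volSq T = (volume : Measure (ℝ × ℝ)).restrict (openSquare T) :=
  Measure.restrict_congr_set
    (Measure.set_prod_ae_eq Ioo_ae_eq_Icc.symm Ioo_ae_eq_Icc.symm)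

theorem ae_mem_openSquare (T : ℝ) : ∀ᵐ x ∂(volSq T), x ∈ openSquare T := by
  rw [volSq_eq_restrict_openSquare]
  exact ae_restrict_mem (isOpen_openSquare T).measurableSet

instance isFiniteMeasure_volSq (T : ℝ) : IsFiniteMeasure (volSq T) :=
  isFiniteMeasure_restrict.2 (isCompact_Icc.prod isCompact_Icc).measure_lt_top.ne

section Luxemburg

variable {T p q : ℝ} {mu : ℝ × ℝ → ℝ}

theorem lintegral_enorm_rpow_le_modular (hp : 0 < p) (hmu : ∀ᵐ x ∂(volSq T), 0 ≤ mu x)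
    (u : ℝ × ℝ → ℝ) : ∫⁻ x, ‖u x‖ₑ ^ p ∂(volSq T) ≤ modular T p q mu u := by
  refine lintegral_mono_ae ?_
  filter_upwards [hmu] with x hx
  rw [← ofReal_norm, ENNReal.ofReal_rpow_of_nonneg (norm_nonneg _) hp.le,
    Real.norm_eq_abs]
  refine ENNReal.ofReal_le_ofReal ?_
  have := mul_nonneg hx (Real.rpow_nonneg (abs_nonneg (u x)) q)
  linarith

theorem eLpNorm_le_modular_rpow (hp : 0 < p) (hmu : ∀ᵐ x ∂(volSq T), 0 ≤ mu x)
    (u : ℝ × ℝ → ℝ) :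
    eLpNorm u (ENNReal.ofReal p) (volSq T) ≤ modular T p q mu u ^ (1 / p) := by
  rw [eLpNorm_eq_lintegral_rpow_enorm_toReal (by simpa) ENNReal.ofReal_ne_top,
    ENNReal.toReal_ofReal hp.le]
  exact ENNReal.rpow_le_rpow (lintegral_enorm_rpow_le_modular hp hmu u) (by positivity)

/-- For each admissible `τ`, dropping the nonnegative `μ` term gives `‖u/τ‖_p^p ≤ ρ(u/τ) ≤ 1`. -/
theorem eLpNorm_le_luxNorm (hp : 0 < p) (hmu : ∀ᵐ x ∂(volSq T), 0 ≤ mu x)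
    (u : ℝ × ℝ → ℝ) : eLpNorm u (ENNReal.ofReal p) (volSq T) ≤ luxNorm T p q mu u := by
  refine le_iInf fun τ => le_iInf fun hτ => le_iInf fun h => ?_
  have e : u = τ • fun x => u x / τ := by
    ext x
    simp only [Pi.smul_apply, smul_eq_mul]
    field_simp
  rw [e, eLpNorm_const_smul, Real.enorm_eq_ofReal hτ.le]
  refine mul_le_of_le_one_right' ((eLpNorm_le_modular_rpow (q := q) hp hmu _).trans ?_)
  exact (ENNReal.rpow_le_rpow h (by positivity)).trans_eq (ENNReal.one_rpow _)

theorem MemLH.memLp (hp : 0 < p) (hmu : ∀ᵐ x ∂(volSq T), 0 ≤ mu x) {u : ℝ × ℝ → ℝ}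
    (hu : MemLH T p q mu u) : MemLp u (ENNReal.ofReal p) (volSq T) :=
  ⟨hu.1.aestronglyMeasurable, (eLpNorm_le_modular_rpow hp hmu u).trans_lt
    (ENNReal.rpow_lt_top_of_nonneg (by positivity) hu.2.ne)⟩

theorem toReal_eLpNorm_eq (hp : 0 < p) {u : ℝ × ℝ → ℝ}
    (hu : MemLp u (ENNReal.ofReal p) (volSq T)) :
    (eLpNorm u (ENNReal.ofReal p) (volSq T)).toReal
      = (∫ x, |u x| ^ p ∂(volSq T)) ^ (1 / p) := by
  rw [hu.eLpNorm_eq_integral_rpow_norm (by simpa) ENNReal.ofReal_ne_top,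
    ENNReal.toReal_ofReal hp.le, one_div, ENNReal.toReal_ofReal]
  · rfl
  · exact Real.rpow_nonneg (integral_nonneg fun x => Real.rpow_nonneg (norm_nonneg _) _) _

end Luxemburg

/-! ### The `L^∞` embedding and the resulting integral bounds -/

/-- The embedding of the fractional space into `L^∞`. -/
theorem exists_ae_abs_le_of_isHilferDeriv {T : ℝ} (hT : 0 < T)
    {ψ : ℝ → ℝ} (hψ : ContDiffOn ℝ 1 ψ (Set.Icc 0 T)) (hψ_mono : StrictMonoOn ψ (Set.Icc 0 T))
    (hψ_deriv : ∀ x ∈ Set.Icc 0 T, derivWithin ψ (Set.Icc 0 T) x ≠ 0)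
    {p q α β : ℝ} (hp : 1 < p) (hα1 : 1 / p < α) (hα2 : α ≤ 1) (hβ0 : 0 ≤ β) (hβ1 : β ≤ 1)
    {mu : ℝ × ℝ → ℝ} (hmu : ∀ᵐ x ∂(volSq T), 0 ≤ mu x) :
    ∃ C : ℝ, 0 ≤ C ∧ ∀ u v, IsHilferDeriv T ψ α β p q mu u v →
      ∀ᵐ x ∂(volSq T), |u x| ≤ C * (∫ t, |v t| ^ p ∂(volSq T)) ^ (1 / p) := by
  obtain ⟨Ψ, d, H, hΨ, hd⟩ := exists_isIncreasingC1_extension hT hψ hψ_mono hψ_deriv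
  obtain ⟨C, hC, hbound⟩ := H.exists_abs_tensorOp_le (α := α) hT hp hα1
  have hp0 : 0 < p := by linarith
  have hα0 : 0 < α := lt_trans (by positivity) hα1
  refine ⟨C, hC, fun u v ⟨hu, hv, φ, hφ, hφu, hφv⟩ => ?_⟩
  choose w hwc hw hφw using fun n => H.exists_hilferClassical_eq hΨ hd hα0 hα2 hβ0 hβ1 (hφ n)
  have hvL := hv.memLp hp0 hmu
  have hwL : ∀ n, MemLp (w n) (ENNReal.ofReal p) (volSq T) := fun n => by
    rw [← integrable_norm_rpow_iff ((hwc n).aestronglyMeasurable) (by simpa)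
      ENNReal.ofReal_ne_top, ENNReal.toReal_ofReal hp0.le]
    have : Continuous fun t => ‖w n t‖ ^ p :=
      Continuous.rpow_const (hwc n).norm fun _ => Or.inr hp0.le
    exact this.continuousOn.integrableOn_compact (isCompact_Icc.prod isCompact_Icc)
  have hφu' : Tendsto (fun n => eLpNorm (φ n - u) (ENNReal.ofReal p) (volSq T)) atTop (𝓝 0) :=
    tendsto_of_tendsto_of_tendsto_of_le_of_le tendsto_const_nhds hφu (fun _ => zero_le)
      fun n => eLpNorm_le_luxNorm hp0 hmu _
  have hwv : Tendsto (fun n => eLpNorm (w n - v) (ENNReal.ofReal p) (volSq T)) atTop (𝓝 0) := by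
    refine tendsto_of_tendsto_of_tendsto_of_le_of_le tendsto_const_nhds hφv (fun _ => zero_le)
      fun n => le_trans (le_of_eq (eLpNorm_congr_ae ?_)) (eLpNorm_le_luxNorm hp0 hmu _)
    filter_upwards [ae_mem_openSquare T] with x hx
    rw [Pi.sub_apply, hw n hx]
  -- Convergence in `L^p` yields an almost everywhere convergent subsequence, along which the
  -- uniform bound passes to the limit pointwise.
  obtain ⟨ns, hns, hae⟩ := (tendstoInMeasure_of_tendsto_eLpNorm (by simpa)
    (fun n => (hφ n).1.continuous.aestronglyMeasurable) hu.1.aestronglyMeasurable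
    hφu').exists_seq_tendsto_ae
  filter_upwards [hae, ae_mem_openSquare T] with x hx hxs
  set N := fun f : ℝ × ℝ → ℝ => (eLpNorm f (ENNReal.ofReal p) (volSq T)).toReal with hN
  have hle : ∀ n, |φ n x| ≤ C * (N (w n - v) + N v) := by
    intro n
    rw [hφw n hxs]
    refine (hbound (w n) (hwc n) x hxs).trans (mul_le_mul_of_nonneg_left ?_ hC)
    rw [← toReal_eLpNorm_eq hp0 (hwL n), hN]
    have h1 := eLpNorm_add_le ((hwL n).sub hvL).1 hvL.1
      (p := ENNReal.ofReal p) (by simpa using hp.le)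
    rw [sub_add_cancel] at h1
    have h2 := ENNReal.toReal_mono
      (ENNReal.add_ne_top.2 ⟨((hwL n).sub hvL).2.ne, hvL.2.ne⟩) h1
    rwa [ENNReal.toReal_add ((hwL n).sub hvL).2.ne hvL.2.ne] at h2
  have h0 : Tendsto (fun n => N (w n - v)) atTop (𝓝 0) := by
    have := (ENNReal.tendsto_toReal ENNReal.zero_ne_top).comp hwv
    rwa [ENNReal.toReal_zero] at this
  have hlim : Tendsto (fun n => C * (N (w (ns n) - v) + N v)) atTop (𝓝 (C * (0 + N v))) :=
    ((h0.comp hns.tendsto_atTop).add_const _).const_mul _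
  have hNv : N v = (∫ t, |v t| ^ p ∂(volSq T)) ^ (1 / p) := toReal_eLpNorm_eq hp0 hvL
  rw [← hNv, ← zero_add (N v)]
  exact le_of_tendsto_of_tendsto' hx.abs hlim fun n => hle (ns n)

theorem integral_rpow_le_of_ae_abs_le {T s M c : ℝ} (hs : 0 ≤ s) {b u : ℝ × ℝ → ℝ}
    (hb0 : ∀ᵐ x ∂(volSq T), 0 ≤ b x) (hb : ∀ᵐ x ∂(volSq T), b x ≤ c)
    (hu : ∀ᵐ x ∂(volSq T), |u x| ≤ M) :
    ∫ x, b x * |u x| ^ s ∂(volSq T) ≤ c * (volSq T).real Set.univ * M ^ s := by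
  have h : ∫ _, c * M ^ s ∂(volSq T) = c * (volSq T).real Set.univ * M ^ s := by
    rw [integral_const, smul_eq_mul]
    ring
  rw [← h]
  refine integral_mono_of_nonneg ?_ (integrable_const _) ?_
  · filter_upwards [hb0] with x hx using mul_nonneg hx (Real.rpow_nonneg (abs_nonneg _) _)
  · filter_upwards [hb0, hb, hu] with x h0 h1 h2
    exact mul_le_mul h1 (Real.rpow_le_rpow (abs_nonneg _) h2 hs)
      (Real.rpow_nonneg (abs_nonneg _) _) (h0.trans h1)

/-! ### Sign of the energy -/

/-- The algebraic part of the sign of the energy on the set `N_λ^-`: the constraints force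
the gradient term `A` to be large when `λ` is small. -/
theorem exists_forall_energy_nonneg {p q r γ c₁ c₂ lamHat : ℝ} (hp : 1 < p) (hpq : p < q)
    (hqr : q < r) (hγ0 : 0 < γ) (hγ1 : γ < 1) (hc₁ : 0 ≤ c₁) (hc₂ : 0 ≤ c₂) (hl : 0 < lamHat) :
    ∃ lam₀ ∈ Set.Ioc 0 lamHat, ∀ lam ∈ Set.Ioc 0 lam₀, ∀ A B S R : ℝ, 0 ≤ A → 0 ≤ B →
      R ≤ c₁ * A ^ (r / p) → S ≤ c₂ * A ^ ((1 - γ) / p) → A + B = S + lam * R →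
      (p + γ - 1) * A + (q + γ - 1) * B - lam * (r + γ - 1) * R < 0 →
      0 ≤ 1 / p * A + 1 / q * B - 1 / (1 - γ) * S - lam / r * R := by
  have hp0 : 0 < p := by linarith
  have hq0 : 0 < q := by linarith
  have hr0 : 0 < r := by linarith
  have hγ' : 0 < 1 - γ := by linarith
  have hκ : 0 < 1 / p - 1 / r := sub_pos.2 (one_div_lt_one_div_of_lt hp0 (by linarith))
  have hκq : 0 < 1 / q - 1 / r := sub_pos.2 (one_div_lt_one_div_of_lt hq0 hqr)
  have he : 0 < 1 / (1 - γ) - 1 / r := sub_pos.2 (one_div_lt_one_div_of_lt hγ' (by linarith))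
  have hm : 0 < 1 - (1 - γ) / p := sub_pos.2 ((div_lt_one hp0).2 (by linarith))
  set κ := 1 / p - 1 / r with hκd
  set e := 1 / (1 - γ) - 1 / r with hed
  set m := 1 - (1 - γ) / p with hmd
  -- The threshold beyond which `e * c₂ * A ^ ((1 - γ) / p) ≤ κ * A`.
  set A₀ := (e * c₂ / κ) ^ (1 / m) with hA₀
  have hA₀0 : 0 ≤ A₀ := by positivity
  have hrp : 0 < r / p - 1 := sub_pos.2 ((one_lt_div hp0).2 (by linarith))
  have hpg : 0 < p + γ - 1 := by linarith
  have hrg : 0 < r + γ - 1 := by linarith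
  have hqg : 0 < q + γ - 1 := by linarith
  -- Chosen so that `(r + γ - 1) * R ≤ Q * A` whenever `0 < A < A₀`. The added ones keep `Q`
  -- positive when `c₁` or `A₀` is zero.
  set Q := (r + γ - 1) * (c₁ + 1) * (A₀ ^ (r / p - 1) + 1) with hQ
  have hQ0 : 0 < Q := by positivity
  refine ⟨min lamHat ((p + γ - 1) / Q), ⟨lt_min hl (div_pos hpg hQ0), min_le_left _ _⟩, ?_⟩
  rintro lam ⟨hlam, hlam₀⟩ A B S R hA hB hR hS heq hneg
  have hlamQ : lam * Q ≤ p + γ - 1 := by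
    rw [← le_div_iff₀ hQ0]
    exact hlam₀.trans (min_le_right _ _)
  have hlt : (p + γ - 1) * A < lam * (r + γ - 1) * R := by
    have := mul_nonneg hqg.le hB
    linarith
  have hA : 0 < A := by
    refine lt_of_le_of_ne hA fun h => ?_
    rw [← h, Real.zero_rpow (div_pos hr0 hp0).ne', mul_zero] at hR
    rw [← h, mul_zero] at hlt
    have := mul_nonneg (mul_pos hlam hrg).le (neg_nonneg.2 hR)
    linarith
  -- Otherwise `(p + γ - 1) * A < lam * Q * A ≤ (p + γ - 1) * A`, which is absurd.
  have hAA₀ : A₀ ≤ A := by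
    by_contra! hlt'
    have h1 : A ^ (r / p) = A ^ (r / p - 1) * A := by
      rw [Real.rpow_sub_one hA.ne']
      field_simp
    have h2 : A ^ (r / p - 1) ≤ A₀ ^ (r / p - 1) := Real.rpow_le_rpow hA.le hlt'.le hrp.le
    have h3 : R ≤ (c₁ + 1) * (A₀ ^ (r / p - 1) + 1) * A := by
      refine hR.trans ?_
      rw [h1, ← mul_assoc]
      have := Real.rpow_nonneg hA.le (r / p - 1)
      gcongr
      · linarith
      · linarith
    have h4 := mul_le_mul_of_nonneg_left h3 (mul_pos hlam hrg).le
    have h5 := mul_le_mul_of_nonneg_right hlamQ hA.le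
    have h6 : lam * (r + γ - 1) * ((c₁ + 1) * (A₀ ^ (r / p - 1) + 1) * A) = lam * Q * A := by
      rw [hQ]
      ring
    linarith
  have h1 : e * c₂ / κ ≤ A ^ m := by
    have := Real.rpow_le_rpow hA₀0 hAA₀ hm.le
    rwa [hA₀, ← Real.rpow_mul (by positivity), one_div, inv_mul_cancel₀ hm.ne',
      Real.rpow_one] at this
  have h2 : A ^ m * A ^ ((1 - γ) / p) = A := by
    rw [← Real.rpow_add hA, hmd, sub_add_cancel, Real.rpow_one]
  have h3 : e * (c₂ * A ^ ((1 - γ) / p)) ≤ κ * A := by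
    rw [div_le_iff₀ hκ] at h1
    have := mul_le_mul_of_nonneg_right h1 (Real.rpow_nonneg hA.le ((1 - γ) / p))
    calc e * (c₂ * A ^ ((1 - γ) / p)) = e * c₂ * A ^ ((1 - γ) / p) := by ring
      _ ≤ A ^ m * κ * A ^ ((1 - γ) / p) := this
      _ = κ * (A ^ m * A ^ ((1 - γ) / p)) := by ring
      _ = κ * A := by rw [h2]
  have h4 := mul_le_mul_of_nonneg_left hS he.le
  have h5 := mul_nonneg hκq.le hB
  have h6 : 1 / p * A + 1 / q * B - 1 / (1 - γ) * S - lam / r * R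
      = κ * A + (1 / q - 1 / r) * B - e * S := by
    have : lam * R = A + B - S := by linarith
    have h7 : lam / r * R = 1 / r * (A + B - S) := by
      rw [← this]
      ring
    rw [h7, hκd, hed]
    ring
  rw [h6]
  linarith

end DoublePhase

end

theorem proposition3p8
    (T : ℝ) (hT : 0 < T)
    (ψ : ℝ → ℝ) (hψ : ContDiffOn ℝ 1 ψ (Set.Icc 0 T)) (hψ_mono : StrictMonoOn ψ (Set.Icc 0 T))
    (hψ_deriv : ∀ x ∈ Set.Icc 0 T, derivWithin ψ (Set.Icc 0 T) x ≠ 0)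
    (p q r α β γ : ℝ)
    (hp1 : 1 < p) (hp2 : p < 2) (hα1 : 1 / p < α) (hα2 : α < 1) (hβ0 : 0 ≤ β) (hβ1 : β ≤ 1)
    (hpq : p < q) (hq : q < 2 * p / (2 - α * p))
    (hγ0 : 0 < γ) (hγ1 : γ < 1)
    (hqr : q < r) (hr : r < 2 * p / (2 - α * p))
    (mu : ℝ × ℝ → ℝ) (hmu : MemLp mu ⊤ (DoublePhase.volSq T))
    (hmu0 : ∀ᵐ x ∂(DoublePhase.volSq T), 0 ≤ mu x)
    (a : ℝ × ℝ → ℝ) (ha : MemLp a ⊤ (DoublePhase.volSq T))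
    (ha0 : ∀ᵐ x ∂(DoublePhase.volSq T), 0 < a x)
    (lamHat : ℝ) (hlamHat : 0 < lamHat) :
    ∃ lam₀ ∈ Set.Ioc 0 lamHat, ∀ lam ∈ Set.Ioc 0 lam₀,
      ∀ u ∈ DoublePhase.nehariMinus T ψ α β p q r γ mu a lam,
        0 ≤ DoublePhase.energy T ψ α β p q r γ mu a lam u := by
  obtain ⟨C, hC, hemb⟩ := DoublePhase.exists_ae_abs_le_of_isHilferDeriv (q := q) hT hψ hψ_mono
    hψ_deriv hp1 hα1 hα2.le hβ0 hβ1 hmu0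
  have hr0 : 0 ≤ r := by linarith
  set c := (eLpNorm a ⊤ (DoublePhase.volSq T)).toReal with hc
  have hac : ∀ᵐ x ∂(DoublePhase.volSq T), a x ≤ c := by
    filter_upwards [ae_le_eLpNormEssSup (f := a) (μ := DoublePhase.volSq T)] with x hx
    rw [← eLpNorm_exponent_top] at hx
    have := ENNReal.toReal_mono ha.2.ne hx
    rw [toReal_enorm] at this
    exact (le_abs_self _).trans this
  set V := (DoublePhase.volSq T).real Set.univ with hV
  have hc0 : 0 ≤ c := ENNReal.toReal_nonneg
  have hV0 : 0 ≤ V := measureReal_nonneg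
  obtain ⟨lam₀, hlam₀, hmain⟩ := DoublePhase.exists_forall_energy_nonneg hp1 hpq hqr hγ0 hγ1
    (c₁ := 1 * V * C ^ r) (c₂ := c * V * C ^ (1 - γ)) (by positivity) (by positivity) hlamHat
  refine ⟨lam₀, hlam₀, fun lam hlam u hu => ?_⟩
  obtain ⟨⟨hfrac, -, heq⟩, hneg⟩ := hu
  -- The embedding holds for every `v` in the closure of the graph over `u`, so it applies to the
  -- chosen one whatever the choice.
  have hD : DoublePhase.IsHilferDeriv T ψ α β p q mu u
      (DoublePhase.hilferD T ψ α β p q mu u) := by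
    have h : ∃ v, DoublePhase.IsHilferDeriv T ψ α β p q mu u v := hfrac
    rw [DoublePhase.hilferD, dif_pos h]
    exact h.choose_spec
  set A := DoublePhase.gradP T ψ α β p q mu u with hA
  have hA0 : 0 ≤ A := integral_nonneg fun x => Real.rpow_nonneg (abs_nonneg _) _
  have hbd : ∀ᵐ x ∂(DoublePhase.volSq T), |u x| ≤ C * A ^ (1 / p) := hemb u _ hD
  have hpow : ∀ s : ℝ, (C * A ^ (1 / p)) ^ s = C ^ s * A ^ (s / p) := fun s => by
    rw [Real.mul_rpow hC (Real.rpow_nonneg hA0 _), ← Real.rpow_mul hA0, one_div_mul_eq_div]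
  refine hmain lam hlam A (DoublePhase.gradQ T ψ α β p q mu u) (DoublePhase.singTerm T γ a u)
    (DoublePhase.powR T r u) hA0 ?_ ?_ ?_ heq hneg
  · refine integral_nonneg_of_ae ?_
    filter_upwards [hmu0] with x hx using mul_nonneg hx (Real.rpow_nonneg (abs_nonneg _) _)
  · have := DoublePhase.integral_rpow_le_of_ae_abs_le (b := fun _ => 1) (c := 1) hr0
      (Eventually.of_forall fun _ => zero_le_one) (Eventually.of_forall fun _ => le_rfl) hbd
    simp only [one_mul (|u _| ^ r)] at this
    rw [hpow, ← mul_assoc] at this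
    exact this
  · have := DoublePhase.integral_rpow_le_of_ae_abs_le (sub_nonneg.2 hγ1.le)
      (ha0.mono fun _ => le_of_lt) hac hbd
    rw [hpow, ← mul_assoc] at this
    exact this
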